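/- **Setting.** Let the underlying graph be the path with stations $1,\dots,n$ and edges $(e,e+1)$, $1\le e<n$, and let $\mathcal L$ be a finite set of distinct lines $l=[i,j]$ with $1\le i<j\le n$; such a line runs along the edges $(e,e+1)$ with $i\le e<j$, and $i$, $j$ are its left and right end. A *layout* gives, for each edge $(e,e+1)$, two linear orders (from bottom to top) of the lines on that edge, one at station $e$ and one at station $e+1$. Two lines cross on an edge if their order is different at its two stations; the crossing number of a layout is the total number of such crossings over all edges. A layout is *admissible* if at each station $v$ the lines passing through $v$ appear in the same order on the two sides of $v$. It satisfies the *periphery condition* if every line $l$ is, at each of its two ends $v$ and on its edge incident to $v$ there, either above all or below all lines of that edge that do not end at $v$. The problem MLCM-P\_PATH asks for an admissible layout with the periphery condition and with minimum crossing number. An *assignment* chooses top or bottom for each end of each line; a layout *respects* it if, on each side of each station, the lines whose end there is assigned to top are above all other lines there, and those whose end there is assigned to bottom are below all other lines there. MLCM-PA asks, for a given assignment, for an admissible layout with minimum crossing number among those that respect the assignment. An assignment is *optimal* if it is respected by some solution of MLCM-P\_PATH. Algorithms are programs of a unit-cost random access machine (registers, indirectly addressed memory, addition, truncated subtraction, comparison,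 branching and loops) that on the given inputs only use numbers bounded by a fixed polynomial in $n+|\mathcal L|$. **Theorem.** MLCM-P\_PATH is solved in $O^*(2^{|\mathcal L|})$ time. More precisely, there are programs $A$ and $B$ and constants $C,d$ such that for every $n$ and every set of lines $\mathcal L$: 1. given $n$ and $\mathcal L$ (as a list in arbitrary order), $A$ computes an optimal assignment in at most $C\,(2^{|\mathcal L|}\,|\mathcal L|^2+1)$ steps; 2. given $n$, $\mathcal L$ and any assignment, $B$ computes a solution of MLCM-PA in at most $C\,(n+|\mathcal L|+1)^d$ steps; 3. running $A$ and then $B$ on its output solves MLCM-P\_PATH: it computes an admissible layout with the periphery condition and minimum crossing number, in at most $C\,\bigl(2^{|\mathcal L|}\,|\mathcal L|^2+(n+|\mathcal L|+1)^d\bigr)$ steps. -/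

import Mathlib

/-! ## The machine model: a random access machine with unit-cost instructions

The machine has numbered registers and a memory of cells addressed by natural numbers. Its only
arithmetic is addition and truncated subtraction, memory can be addressed indirectly, and control
flow is given by sequencing, branching and looping. Every node of an expression and every command
or test that is executed costs one step. Runs are taken with a word bound `W`: no number above `W`
may ever be used or produced. -/

namespace RAM

structure State where
  reg : ℕ → ℕ
  mem : ℕ → ℕ

inductive Expr where
  | const (c : ℕ)
  | reg (r : ℕ)
  | load (a : Expr)
  | add (a b : Expr)
  | sub (a b : Expr)

namespace Expr

def eval (s : State) : Expr → ℕ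
  | const c => c
  | reg r => s.reg r
  | load a => s.mem (eval s a)
  | add a b => eval s a + eval s b
  | sub a b => eval s a - eval s b

/-- The number of steps taken to evaluate an expression. -/
def cost : Expr → ℕ
  | const _ => 1
  | reg _ => 1
  | load a => cost a + 1
  | add a b => cost a + cost b + 1
  | sub a b => cost a + cost b + 1

/-- All values met while evaluating the expression are at most `W`. -/
def Fits (W : ℕ) (s : State) : Expr → Prop
  | const c => c ≤ W
  | reg r => s.reg r ≤ W
  | load a => Fits W s a ∧ s.mem (eval s a) ≤ W
  | add a b => Fits W s a ∧ Fits W s b ∧ eval s a + eval s b ≤ W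
  | sub a b => Fits W s a ∧ Fits W s b

end Expr

/-- Programs. `store a e` writes the value of `e` into the memory cell whose address is the value
of `a`; `branch x y c d` runs `c` if `x < y` and `d` otherwise; `loop x y c` repeats `c` as long as
`x < y`. -/
inductive Program where
  | skip
  | assign (r : ℕ) (e : Expr)
  | store (a e : Expr)
  | seq (c d : Program)
  | branch (x y : Expr) (c d : Program)
  | loop (x y : Expr) (c : Program)

/-- `Exec W P s s' t`: with word bound `W`, the program `P` started in state `s` halts in state
`s'` after exactly `t` steps. -/
inductive Exec (W : ℕ) : Program → State → State → ℕ → Prop where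
  | skip (s : State) : Exec W .skip s s 1
  | assign (s : State) (r : ℕ) (e : Expr) (he : e.Fits W s) :
      Exec W (.assign r e) s { s with reg := Function.update s.reg r (e.eval s) } (e.cost + 1)
  | store (s : State) (a e : Expr) (ha : a.Fits W s) (he : e.Fits W s) :
      Exec W (.store a e) s { s with mem := Function.update s.mem (a.eval s) (e.eval s) }
        (a.cost + e.cost + 1)
  | seq {s s₁ s₂ : State} {c d : Program} {t₁ t₂ : ℕ}
      (h₁ : Exec W c s s₁ t₁) (h₂ : Exec W d s₁ s₂ t₂) :
      Exec W (.seq c d) s s₂ (t₁ + t₂)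
  | branch_true {s s₁ : State} {x y : Expr} {c d : Program} {t : ℕ}
      (hx : x.Fits W s) (hy : y.Fits W s) (hlt : x.eval s < y.eval s) (h : Exec W c s s₁ t) :
      Exec W (.branch x y c d) s s₁ (x.cost + y.cost + 1 + t)
  | branch_false {s s₁ : State} {x y : Expr} {c d : Program} {t : ℕ}
      (hx : x.Fits W s) (hy : y.Fits W s) (hge : y.eval s ≤ x.eval s) (h : Exec W d s s₁ t) :
      Exec W (.branch x y c d) s s₁ (x.cost + y.cost + 1 + t)
  | loop_stop {s : State} {x y : Expr} {c : Program}
      (hx : x.Fits W s) (hy : y.Fits W s) (hge : y.eval s ≤ x.eval s) :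
      Exec W (.loop x y c) s s (x.cost + y.cost + 1)
  | loop_step {s s₁ s₂ : State} {x y : Expr} {c : Program} {t₁ t₂ : ℕ}
      (hx : x.Fits W s) (hy : y.Fits W s) (hlt : x.eval s < y.eval s)
      (h₁ : Exec W c s s₁ t₁) (h₂ : Exec W (.loop x y c) s₁ s₂ t₂) :
      Exec W (.loop x y c) s s₂ (x.cost + y.cost + 1 + t₁ + t₂)

/-- The memory begins with the list `x`; nothing is said about the other cells. -/
def Holds (s : State) (x : List ℕ) : Prop :=
  ∀ (i : ℕ) (h : i < x.length), s.mem i = x[i]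

/-- With words bounded by `W`, the program `P` turns the input `x` into the output `y` in at most
`T` steps, whatever the registers and the rest of the memory contain at the start. -/
def Computes (W T : ℕ) (P : Program) (x y : List ℕ) : Prop :=
  ∀ s, Holds s x → ∃ s' t, Exec W P s s' t ∧ t ≤ T ∧ Holds s' y

end RAM

/-! ## Metro lines on a path -/

/-- The underlying path has the stations `1, …, n` and the edges `(e, e + 1)` for `1 ≤ e < n`; there
are `k` distinct lines, and line `l` runs from its left end `left l` to its right end `right l`. -/
structure MetroPath where
  n : ℕ
  k : ℕ
  left : Fin k → ℕ
  right : Fin k → ℕ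
  one_le_left : ∀ l, 1 ≤ left l
  left_lt_right : ∀ l, left l < right l
  right_le : ∀ l, right l ≤ n
  distinct : ∀ l l', left l = left l' → right l = right l' → l = l'

namespace MetroPath

/-- Line `l` passes along the edge `(e, e + 1)`. -/
def OnEdge (I : MetroPath) (e : ℕ) (l : Fin I.k) : Prop :=
  I.left l ≤ e ∧ e < I.right l

/-- Station `v` is an end of line `l`. -/
def IsEnd (I : MetroPath) (v : ℕ) (l : Fin I.k) : Prop :=
  I.left l = v ∨ I.right l = v

instance (I : MetroPath) (v : ℕ) : DecidablePred (I.IsEnd v) :=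
  fun _ => inferInstanceAs (Decidable (_ ∨ _))

/-- A layout gives, for each edge `(e, e + 1)`, the sequence `near e` of the lines on this edge at
station `e` and the sequence `far e` of the same lines at station `e + 1`, both listed from bottom
to top. (For `e = 0` and `e ≥ n` no line is on the edge, and the sequences are empty.) -/
structure Layout (I : MetroPath) where
  near : ℕ → List (Fin I.k)
  far : ℕ → List (Fin I.k)
  near_nodup : ∀ e, (near e).Nodup
  far_nodup : ∀ e, (far e).Nodup
  mem_near : ∀ e l, l ∈ near e ↔ I.OnEdge e l
  mem_far : ∀ e l, l ∈ far e ↔ I.OnEdge e l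

/-- Both `a` and `b` occur in the sequence `s`, and `a` lies below `b`. -/
def Below {k : ℕ} (s : List (Fin k)) (a b : Fin k) : Prop :=
  a ∈ s ∧ b ∈ s ∧ s.idxOf a < s.idxOf b

instance {k : ℕ} (s : List (Fin k)) (a b : Fin k) : Decidable (Below s a b) :=
  inferInstanceAs (Decidable (_ ∧ _ ∧ _))

/-- Where each end of each line is to be drawn: `true` means top, `false` means bottom. -/
structure Assignment (I : MetroPath) where
  left : Fin I.k → Bool
  right : Fin I.k → Bool

namespace Layout

variable {I : MetroPath}

/-- Every station is admissible: at station `e + 1`, between the edges `(e, e + 1)` and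
`(e + 1, e + 2)`, the lines that do not end there go through without crossing. -/
def Admissible (Λ : Layout I) : Prop :=
  ∀ e, ((Λ.far e).filter (fun l => ¬ I.IsEnd (e + 1) l)).Sublist (Λ.near (e + 1)) ∧
    ((Λ.near (e + 1)).filter (fun l => ¬ I.IsEnd (e + 1) l)).Sublist (Λ.far e)

/-- The total number of crossings: on each edge, the pairs whose order is reversed. Each crossing
pair is counted once, as the pair `(p.1, p.2)` with `p.1` below `p.2` at the left station. -/
def crossings (Λ : Layout I) : ℕ :=
  ∑ e ∈ Finset.Ico 1 I.n,
    (Finset.univ.filter fun p : Fin I.k × Fin I.k =>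
      Below (Λ.near e) p.1 p.2 ∧ Below (Λ.far e) p.2 p.1).card

/-- In the sequence `s` of lines at station `v`, line `l` is below all, or above all, lines of `s`
that do not end at `v`. -/
def AtVerge (I : MetroPath) (v : ℕ) (s : List (Fin I.k)) (l : Fin I.k) : Prop :=
  (∀ l' ∈ s, ¬ I.IsEnd v l' → Below s l l') ∨ (∀ l' ∈ s, ¬ I.IsEnd v l' → Below s l' l)

/-- Both ends of every line satisfy the periphery condition. -/
def Periphery (Λ : Layout I) : Prop :=
  ∀ l, AtVerge I (I.left l) (Λ.near (I.left l)) l ∧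
    AtVerge I (I.right l) (Λ.far (I.right l - 1)) l

/-- The layout draws every line end as assigned: on either side of a station, the ends there that
are assigned to top lie above all lines except each other, and the ends there that are assigned to
bottom lie below all lines except each other. -/
def Respects (Λ : Layout I) (a : Assignment I) : Prop :=
  ∀ l,
    (∀ l' ∈ Λ.near (I.left l), ¬ (I.left l' = I.left l ∧ a.left l' = a.left l) →
      if a.left l then Below (Λ.near (I.left l)) l' l
      else Below (Λ.near (I.left l)) l l') ∧
    (∀ l' ∈ Λ.far (I.right l - 1), ¬ (I.right l' = I.right l ∧ a.right l' = a.right l) →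
      if a.right l then Below (Λ.far (I.right l - 1)) l' l
      else Below (Λ.far (I.right l - 1)) l l')

/-- `Λ` is a solution of MLCM-P: an admissible layout with the periphery condition that has the
minimum number of crossings among all such layouts. -/
def SolvesP (Λ : Layout I) : Prop :=
  Λ.Admissible ∧ Λ.Periphery ∧
    ∀ Λ' : Layout I, Λ'.Admissible → Λ'.Periphery → Λ.crossings ≤ Λ'.crossings

/-- `Λ` is a solution of MLCM-PA for the assignment `a`: an admissible layout respecting `a` that
has the minimum number of crossings among all such layouts. -/
def SolvesPA (Λ : Layout I) (a : Assignment I) : Prop :=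
  Λ.Admissible ∧ Λ.Respects a ∧
    ∀ Λ' : Layout I, Λ'.Admissible → Λ'.Respects a → Λ.crossings ≤ Λ'.crossings

/-- The output format of a layout: for `e = 1, …, n - 1` in turn, the lines at the left station of
the edge `(e, e + 1)` and then those at its right station, each from bottom to top. -/
def encode (Λ : Layout I) : List ℕ :=
  (List.range' 1 (I.n - 1)).flatMap fun e => (Λ.near e ++ Λ.far e).map Fin.val

end Layout

/-- The assignment `a` is optimal: some layout that respects it is a solution of MLCM-P. -/
def Assignment.Optimal {I : MetroPath} (a : Assignment I) : Prop :=
  ∃ Λ : Layout I, Λ.Respects a ∧ Λ.SolvesP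

/-- The input format: `n`, `k`, and then the two ends of each line. -/
def encode (I : MetroPath) : List ℕ :=
  I.n :: I.k :: (List.finRange I.k).flatMap fun l => [I.left l, I.right l]

/-- For each line the assignments of its left and its right end, `1` for top and `0` for bottom. -/
def Assignment.encode {I : MetroPath} (a : Assignment I) : List ℕ :=
  (List.finRange I.k).flatMap fun l => [(a.left l).toNat, (a.right l).toNat]

end MetroPath

/-!
Fix an assignment. A line that starts at a station where other lines pass lies outside of these, so
the assignment forces the order in which two lines are first seen together, except for lines that
start at the same station on the same side; likewise it forces their order where the first of the
two ends, except for lines that end at the same station on the same side. No crossing happens at a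
station, so two lines whose forced orders differ have to cross on an edge
(`Layout.Admissible.mem_crossingPairs`). Conversely, the forced starting orders all come from one
numerical key per line (`startKey`), with a second key (`endKey`) to separate lines that start
together such that they need not cross later. The layout that sorts the lines by these keys, and
changes their order only by moving each line on its last edge to the side where it ends
(`keyLayout`), has no crossings but the forced ones, each once. Hence it solves MLCM-PA
(`keyLayout_solvesPA`), and a bucket sort computes it in polynomial time.

For an optimal assignment it is enough to search the `2 ^ k` choices `α` of left ends. For given
left ends, consider the right end of a line `i`, and the lines passing through that station. Some of
them are forced to lie below `i` and some above it, and `i` has to cross the former or the latter,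
depending on its side. So every layout has at least as many crossings as the sum of the smaller ones
of these two numbers (`minCrossings_le`). If each right end takes the cheaper side, this bound is
attained (`crossings_keyLayout_complete_le`): crossings between lines that end at the same station
do not occur, because the upper one of two such lines has at least as many lines below it and at
most as many above it, and so does not go to the bottom if the lower one goes to the top. The sum is
computed in time `O(k ^ 2)` for each `α`, and the choices of left ends are listed by a binary
counter.

The programs are verified with a weakest precondition calculus (`RAM.WP`) that keeps track of
running time. For programs that write a list, `RAM.Emits` says which list they append to the output;
the rules for sequences, branches and loops then follow the structure of the list.
-/


/-! ### Sequences of lines -/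

namespace MetroPath

/-- In this form the relation passes to and from filtered sequences, which is how admissibility
is stated. -/
theorem below_iff_sublist {k : ℕ} {s : List (Fin k)} (hs : s.Nodup) (a b : Fin k) :
    Below s a b ↔ [a, b].Sublist s := by
  constructor
  · rintro ⟨ha, hb, hab⟩
    induction s with
    | nil => simp at ha
    | cons x t ih =>
      rw [List.nodup_cons] at hs
      by_cases hxa : x = a
      · subst hxa
        have hbt : b ∈ t := by
          rcases List.mem_cons.1 hb with h | h
          · subst h; omega
          · exact h
        exact (List.singleton_sublist.2 hbt).cons_cons x
      · by_cases hxb : x = b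
        · subst hxb; simp at hab
        · rw [List.idxOf_cons_ne _ hxa, List.idxOf_cons_ne _ hxb] at hab
          refine (ih hs.2 ?_ ?_ (by omega)).cons x
          · exact (List.mem_cons.1 ha).resolve_left (fun h => hxa h.symm)
          · exact (List.mem_cons.1 hb).resolve_left (fun h => hxb h.symm)
  · intro h
    have hp : s.Pairwise fun x y => s.idxOf x < s.idxOf y := by
      rw [List.pairwise_iff_getElem]
      intro i j hi hj hij
      rwa [hs.idxOf_getElem, hs.idxOf_getElem]
    have := hp.sublist h
    exact ⟨h.subset (by simp), h.subset (by simp), by simpa using this⟩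

theorem below_trichotomy {k : ℕ} {s : List (Fin k)} {a b : Fin k} (ha : a ∈ s) (hb : b ∈ s)
    (hab : a ≠ b) : Below s a b ∨ Below s b a := by
  rcases lt_trichotomy (s.idxOf a) (s.idxOf b) with h | h | h
  · exact Or.inl ⟨ha, hb, h⟩
  · exact absurd ((List.idxOf_inj ha).1 h) hab
  · exact Or.inr ⟨hb, ha, h⟩

theorem Below.asymm {k : ℕ} {s : List (Fin k)} {a b : Fin k} (h : Below s a b) :
    ¬ Below s b a := fun h' => lt_asymm h.2.2 h'.2.2

theorem Below.trans {k : ℕ} {s : List (Fin k)} {a b c : Fin k} (h : Below s a b)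
    (h' : Below s b c) : Below s a c := ⟨h.1, h'.2.1, h.2.2.trans h'.2.2⟩

/-- In a strictly sorted sequence, the lower line is the smaller one. -/
theorem Below.rel {k : ℕ} {s : List (Fin k)} (hs : s.Nodup) {R : Fin k → Fin k → Prop}
    (hR : s.Pairwise R) {a b : Fin k} (h : Below s a b) : R a b := by
  simpa using hR.sublist ((below_iff_sublist hs a b).1 h)

theorem below_of_rel {k : ℕ} {s : List (Fin k)} (hs : s.Nodup) {R : Fin k → Fin k → Prop}
    (hR : s.Pairwise R) {a b : Fin k} (ha : a ∈ s) (hb : b ∈ s) (hab : R a b)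
    (hba : ¬ R b a) : Below s a b := by
  have hne : a ≠ b := by rintro rfl; exact hba hab
  exact (below_trichotomy ha hb hne).resolve_right fun h => hba (h.rel hs hR)

theorem nodup_of_pairwise {α : Type*} {s : List α} {R : α → α → Prop} (hR : s.Pairwise R)
    (h : ∀ a, ¬ R a a) : s.Nodup :=
  hR.imp fun {a b} hab => by rintro rfl; exact h a hab

/-! ### Lower bounds on crossings -/

namespace Layout

variable {I : MetroPath}

/-- The pairs of lines that cross somewhere, each with the line first that is below before such a
crossing. -/
def crossingPairs (Λ : Layout I) : Finset (Fin I.k × Fin I.k) :=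
  (Finset.Ico 1 I.n).biUnion fun e =>
    Finset.univ.filter fun p => Below (Λ.near e) p.1 p.2 ∧ Below (Λ.far e) p.2 p.1

theorem mem_crossingPairs {Λ : Layout I} {p q : Fin I.k} :
    (p, q) ∈ Λ.crossingPairs ↔ ∃ e, Below (Λ.near e) p q ∧ Below (Λ.far e) q p := by
  simp only [crossingPairs, Finset.mem_biUnion, Finset.mem_filter, Finset.mem_univ, true_and,
    Finset.mem_Ico]
  constructor
  · rintro ⟨e, -, h⟩; exact ⟨e, h⟩
  · rintro ⟨e, h⟩
    have h₁ := (Λ.mem_near e p).1 h.1.1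
    have := I.one_le_left p
    have := I.right_le p
    unfold OnEdge at h₁
    exact ⟨e, ⟨by omega, by omega⟩, h⟩

theorem card_crossingPairs_le (Λ : Layout I) : Λ.crossingPairs.card ≤ Λ.crossings :=
  Finset.card_biUnion_le

/-- A pair whose order at a station on the left is the reverse of its order at a station on the
right has to cross on an edge in between, since no crossing happens at an admissible station. -/
theorem Admissible.mem_crossingPairs {Λ : Layout I} (hΛ : Λ.Admissible) {p q : Fin I.k}
    {e₁ e₂ : ℕ} (he : e₁ ≤ e₂) (h₁ : Below (Λ.near e₁) p q) (h₂ : Below (Λ.far e₂) q p) :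
    (p, q) ∈ Λ.crossingPairs := by
  rw [Layout.mem_crossingPairs]
  by_contra hno
  push Not at hno
  have hp₁ := (Λ.mem_near _ _).1 h₁.1
  have hq₁ := (Λ.mem_near _ _).1 h₁.2.1
  have hp₂ := (Λ.mem_far _ _).1 h₂.2.1
  have hq₂ := (Λ.mem_far _ _).1 h₂.1
  have key : ∀ e, e₁ ≤ e → e ≤ e₂ → Below (Λ.near e) p q := by
    intro e hle
    induction e, hle using Nat.le_induction with
    | base => exact fun _ => h₁
    | succ e hle ih =>
      intro hle₂
      have hn := ih (by omega)
      have hpe : I.OnEdge e p := (Λ.mem_near _ _).1 hn.1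
      have hqe : I.OnEdge e q := (Λ.mem_near _ _).1 hn.2.1
      have hpq : p ≠ q := by rintro rfl; exact hn.asymm hn
      have hf := (below_trichotomy ((Λ.mem_far _ _).2 hpe) ((Λ.mem_far _ _).2 hqe)
        hpq).resolve_right (hno e hn)
      rw [below_iff_sublist (Λ.far_nodup _)] at hf
      rw [below_iff_sublist (Λ.near_nodup _)]
      have := hf.filter (fun l => ¬ I.IsEnd (e + 1) l)
      rw [List.filter_eq_self.2] at this
      · exact this.trans (hΛ e).1
      · intro l hl
        simp only [OnEdge] at hpe hqe hp₂ hq₂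
        simp only [List.mem_cons, List.not_mem_nil, or_false] at hl
        rw [decide_eq_true_eq]
        rcases hl with rfl | rfl <;> unfold IsEnd <;> omega
  exact hno e₂ (key e₂ he le_rfl) h₂

end Layout

/-! ### Positions that an assignment forces -/

/-- The position of a line at its left end relative to the lines met there, if the left ends are
drawn as in `α`: a line that starts further right lies outside of those already present. -/
def startKey (I : MetroPath) (α : Fin I.k → Bool) (l : Fin I.k) : ℕ :=
  if α l then I.n + I.left l else I.n - I.left l

/-- The position of a line relative to the lines that start at the same station on the same side:
of two such lines the one that ends first takes the side on which it ends. -/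
def endKey (I : MetroPath) (a : Assignment I) (l : Fin I.k) : ℕ :=
  if a.right l then I.n + I.n + 1 - I.right l else I.right l

/-- The group of a line at the right station of edge `(e, e + 1)`, numbered from bottom to top:
`0` and `2` for the lines that end there at the bottom and at the top, `1` for the lines that go
on. The value `3` stands for lines that are not on the edge. -/
def group (I : MetroPath) (a : Assignment I) (e : ℕ) (l : Fin I.k) : ℕ :=
  if e < I.left l then 3 else if e < I.right l then
    if e + 1 < I.right l then 1 else (a.right l).toNat + (a.right l).toNat
  else 3

theorem startKey_lt (I : MetroPath) (α : Fin I.k → Bool) (l : Fin I.k) :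
    I.startKey α l < I.n + I.n + 1 := by
  have := I.left_lt_right l
  have := I.right_le l
  unfold startKey; split <;> omega

theorem endKey_lt (I : MetroPath) (a : Assignment I) (l : Fin I.k) :
    I.endKey a l < I.n + I.n + 1 := by
  have := I.left_lt_right l
  have := I.right_le l
  unfold endKey; split <;> omega

theorem group_lt_three (I : MetroPath) (a : Assignment I) (e : ℕ) (l : Fin I.k) :
    I.group a e l < 3 ↔ I.OnEdge e l := by
  unfold group OnEdge
  cases a.right l <;> simp <;> split_ifs <;> omega

theorem group_eq_one (I : MetroPath) (a : Assignment I) (e : ℕ) (l : Fin I.k) :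
    I.group a e l = 1 ↔ I.left l ≤ e ∧ e + 1 < I.right l := by
  unfold group
  split_ifs <;> omega

theorem group_of_onEdge {I : MetroPath} (a : Assignment I) {e : ℕ} {l : Fin I.k}
    (h : I.OnEdge e l) : I.group a e l =
      if e + 1 < I.right l then 1 else (a.right l).toNat + (a.right l).toNat := by
  unfold OnEdge at h
  unfold group
  rw [if_neg (by omega), if_pos h.2]

theorem left_eq_of_startKey_eq {I : MetroPath} {α : Fin I.k → Bool} {l l' : Fin I.k}
    (h : I.startKey α l = I.startKey α l') : I.left l = I.left l' ∧ α l = α l' := by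
  have := I.left_lt_right l
  have := I.right_le l
  have := I.one_le_left l
  have := I.left_lt_right l'
  have := I.right_le l'
  have := I.one_le_left l'
  unfold startKey at h
  cases h1 : α l <;> cases h2 : α l' <;> simp [h1, h2] at h ⊢ <;> omega

namespace Layout

variable {I : MetroPath} {Λ : Layout I} {a : Assignment I}

theorem Respects.below_near (hΛ : Λ.Respects a) {p q : Fin I.k}
    (hpq : I.left p < I.right q) (hqp : I.left q < I.right p)
    (h : I.startKey a.left p < I.startKey a.left q) :
    Below (Λ.near (max (I.left p) (I.left q))) p q := by
  have hp := hΛ p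
  have hq := hΛ q
  have := I.left_lt_right p
  have := I.right_le p
  have := I.left_lt_right q
  have := I.right_le q
  have hne : ¬ (I.left p = I.left q ∧ a.left p = a.left q) := by
    rintro ⟨h₁, h₂⟩
    simp [startKey, h₁, h₂] at h
  have hp' := hp.1 q
  have hq' := hq.1 p
  simp only [Λ.mem_near, OnEdge] at hp' hq'
  unfold startKey at h
  rcases le_total (I.left p) (I.left q) with hle | hle
  · rw [max_eq_right hle]
    have hq'' := hq' ⟨hle, by omega⟩ hne
    by_cases hb : a.left q
    · simpa [hb] using hq''
    · -- A line that starts at the bottom has the least key among the lines present, so `p` cannot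
      -- have a smaller one.
      simp only [hb, Bool.false_eq_true, if_false] at h hq''
      exfalso
      split_ifs at h with ha
      · omega
      · rcases hle.eq_or_lt with h' | h'
        · exact hne ⟨h', by simp [ha, hb]⟩
        · omega
  · rw [max_eq_left hle]
    have hp'' := hp' ⟨hle, by omega⟩ (fun h' => hne ⟨h'.1.symm, h'.2.symm⟩)
    by_cases hb : a.left p
    · simp only [hb, if_true] at h hp''
      exfalso
      split_ifs at h with ha
      · rcases hle.eq_or_lt with h' | h'
        · exact hne ⟨h'.symm, by simp [ha, hb]⟩
        · omega
      · omega
    · simpa [hb] using hp''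

theorem Respects.below_far (hΛ : Λ.Respects a) {e : ℕ} {p q : Fin I.k}
    (hp : I.OnEdge e p) (hq : I.OnEdge e q) (h : I.group a e p < I.group a e q) :
    Below (Λ.far e) p q := by
  have hp' := (hΛ p).2 q
  have hq' := (hΛ q).2 p
  simp only [Λ.mem_far, OnEdge] at hp' hq'
  rw [group_of_onEdge a hp, group_of_onEdge a hq] at h
  unfold OnEdge at hp hq
  by_cases h₁ : e + 1 < I.right p
  · rw [if_pos h₁] at h
    by_cases h₂ : e + 1 < I.right q
    · simp [h₂] at h
    · have he : I.right q - 1 = e := by omega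
      rw [if_neg h₂] at h
      rw [he] at hq'
      have := hq' hp (by omega)
      cases hb : a.right q
      · simp [hb] at h
      · simpa [hb] using this
  · have he : I.right p - 1 = e := by omega
    rw [if_neg h₁] at h
    rw [he] at hp'
    have hb : a.right p = false := by
      cases hb : a.right p
      · rfl
      · exfalso
        simp [hb] at h
        split_ifs at h
        · omega
        · have := Bool.toNat_le (a.right q); omega
    have := hp' hq (by
      rintro ⟨h₂, h₃⟩
      simp [h₂ ▸ h₁, h₃] at h)
    simpa [hb] using this

end Layout

/-! ### The layout that sorts lines by their keys -/

/-- The order of lines at the left stations of edges: by `startKey`, and then by `endKey`. -/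
def Before (I : MetroPath) (a : Assignment I) (l l' : Fin I.k) : Prop :=
  I.startKey a.left l < I.startKey a.left l' ∨
    I.startKey a.left l = I.startKey a.left l' ∧ I.endKey a l < I.endKey a l'

/-- The order of lines at the right station of edge `(e, e + 1)`: those that end there move to
their side, and otherwise nothing changes. -/
def BeforeFar (I : MetroPath) (a : Assignment I) (e : ℕ) (l l' : Fin I.k) : Prop :=
  I.group a e l < I.group a e l' ∨ I.group a e l = I.group a e l' ∧ I.Before a l l'

theorem Before.asymm {I : MetroPath} {a : Assignment I} {l l' : Fin I.k} (h : I.Before a l l') :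
    ¬ I.Before a l' l := by
  unfold Before at *; omega

theorem BeforeFar.asymm {I : MetroPath} {a : Assignment I} {e : ℕ} {l l' : Fin I.k}
    (h : I.BeforeFar a e l l') : ¬ I.BeforeFar a e l' l := by
  unfold BeforeFar Before at *; omega

/-- All lines sorted by `Before`, as they come out of a bucket sort. -/
def sortedLines (I : MetroPath) (a : Assignment I) : List (Fin I.k) :=
  (List.range (I.n + I.n + 1)).flatMap fun x => (List.range (I.n + I.n + 1)).flatMap fun y =>
    (List.finRange I.k).filter fun l => I.startKey a.left l = x ∧ I.endKey a l = y

theorem mem_sortedLines (I : MetroPath) (a : Assignment I) (l : Fin I.k) :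
    l ∈ I.sortedLines a := by
  have := I.startKey_lt a.left l
  have := I.endKey_lt a l
  simp only [sortedLines, List.mem_flatMap, List.mem_range, List.mem_filter, List.mem_finRange,
    true_and, decide_eq_true_eq]
  exact ⟨_, by omega, _, by omega, rfl, rfl⟩

/-- Lines with the same `startKey` have the same left end, and lines that also have the same `endKey`
have the same right end; so the order is strict. -/
theorem pairwise_sortedLines (I : MetroPath) (a : Assignment I) :
    (I.sortedLines a).Pairwise (I.Before a) := by
  unfold sortedLines
  rw [List.pairwise_flatMap]
  refine ⟨fun x _ => ?_, List.pairwise_lt_range.imp fun {x x'} hx l hl l' hl' => ?_⟩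
  · rw [List.pairwise_flatMap]
    refine ⟨fun y _ => ?_, List.pairwise_lt_range.imp fun {y y'} hy l hl l' hl' => ?_⟩
    · -- Two lines with equal keys have the same ends, so they are the same line.
      refine List.Pairwise.imp_of_mem ?_ ((List.nodup_finRange I.k).filter _)
      intro l l' hl hl' hne
      simp only [List.mem_filter, List.mem_finRange, true_and, decide_eq_true_eq] at hl hl'
      exfalso
      have h := left_eq_of_startKey_eq (hl.1.trans hl'.1.symm)
      have he := hl.2.trans hl'.2.symm
      apply hne
      refine I.distinct _ _ h.1 ?_
      have := I.right_le l
      have := I.right_le l'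
      unfold endKey at he
      split_ifs at he <;> omega
    · simp only [List.mem_filter, List.mem_finRange, true_and, decide_eq_true_eq] at hl hl'
      unfold Before; omega
  · simp only [List.mem_flatMap, List.mem_filter, List.mem_finRange, true_and,
      decide_eq_true_eq] at hl hl'
    obtain ⟨_, _, hl⟩ := hl
    obtain ⟨_, _, hl'⟩ := hl'
    unfold Before; omega

theorem nodup_sortedLines (I : MetroPath) (a : Assignment I) : (I.sortedLines a).Nodup :=
  nodup_of_pairwise (I.pairwise_sortedLines a) fun _ h => h.asymm h

theorem length_sortedLines (I : MetroPath) (a : Assignment I) :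
    (I.sortedLines a).length = I.k := by
  have h : (I.sortedLines a).Perm (List.finRange I.k) :=
    (List.perm_ext_iff_of_nodup (I.nodup_sortedLines a) (List.nodup_finRange _)).2
      fun l => by simp [mem_sortedLines]
  simpa using h.length_eq

/-- The lines of edge `(e, e + 1)` at its right station. -/
def farLines (I : MetroPath) (a : Assignment I) (e : ℕ) : List (Fin I.k) :=
  (List.range 3).flatMap fun g => (I.sortedLines a).filter fun l => I.group a e l = g

theorem pairwise_farLines (I : MetroPath) (a : Assignment I) (e : ℕ) :
    (I.farLines a e).Pairwise (I.BeforeFar a e) := by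
  unfold farLines
  rw [List.pairwise_flatMap]
  refine ⟨fun x _ => ?_, List.pairwise_lt_range.imp fun {x x'} hx l hl l' hl' => ?_⟩
  · refine List.Pairwise.imp_of_mem ?_ ((I.pairwise_sortedLines a).filter _)
    intro l l' hl hl' h
    simp only [List.mem_filter, decide_eq_true_eq] at hl hl'
    exact Or.inr ⟨hl.2.trans hl'.2.symm, h⟩
  · simp only [List.mem_filter, decide_eq_true_eq] at hl hl'
    exact Or.inl (by omega)

/-- The layout in which lines keep the order given by their keys, except that on its last edge a
line moves to the side where it ends. -/
def keyLayout (I : MetroPath) (a : Assignment I) : Layout I where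
  near e := (I.sortedLines a).filter fun l => I.group a e l < 3
  far e := I.farLines a e
  near_nodup e := (I.nodup_sortedLines a).filter _
  far_nodup e := nodup_of_pairwise (I.pairwise_farLines a e) fun _ h => h.asymm h
  mem_near e l := by simp [mem_sortedLines, group_lt_three]
  mem_far e l := by simp [farLines, mem_sortedLines, ← group_lt_three (a := a)]

theorem Below.before {I : MetroPath} {a : Assignment I} {e : ℕ} {p q : Fin I.k}
    (h : Below ((I.keyLayout a).near e) p q) : I.Before a p q :=
  h.rel ((I.keyLayout a).near_nodup e) ((I.pairwise_sortedLines a).filter _)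

theorem Below.beforeFar {I : MetroPath} {a : Assignment I} {e : ℕ} {p q : Fin I.k}
    (h : Below ((I.keyLayout a).far e) p q) : I.BeforeFar a e p q :=
  h.rel ((I.keyLayout a).far_nodup e) (I.pairwise_farLines a e)

theorem below_near_of_before {I : MetroPath} {a : Assignment I} {e : ℕ} {p q : Fin I.k}
    (hp : I.OnEdge e p) (hq : I.OnEdge e q) (h : I.Before a p q) :
    Below ((I.keyLayout a).near e) p q :=
  below_of_rel ((I.keyLayout a).near_nodup e) ((I.pairwise_sortedLines a).filter _)
    (((I.keyLayout a).mem_near e p).2 hp) (((I.keyLayout a).mem_near e q).2 hq) h h.asymm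

theorem below_far_of_beforeFar {I : MetroPath} {a : Assignment I} {e : ℕ} {p q : Fin I.k}
    (hp : I.OnEdge e p) (hq : I.OnEdge e q) (h : I.BeforeFar a e p q) :
    Below ((I.keyLayout a).far e) p q :=
  below_of_rel ((I.keyLayout a).far_nodup e) (I.pairwise_farLines a e)
    (((I.keyLayout a).mem_far e p).2 hp) (((I.keyLayout a).mem_far e q).2 hq) h h.asymm

theorem keyLayout_admissible (I : MetroPath) (a : Assignment I) :
    (I.keyLayout a).Admissible := by
  intro e
  -- Both sides of the station restrict to the sorted list of the lines passing through it.
  have hfar : ((I.keyLayout a).far e).filter (fun l => ¬ I.IsEnd (e + 1) l) =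
      (I.sortedLines a).filter fun l => I.group a e l = 1 := by
    have h : ∀ g, ((I.sortedLines a).filter fun l => I.group a e l = g).filter
        (fun l => ¬ I.IsEnd (e + 1) l) =
          (I.sortedLines a).filter fun l => I.group a e l = g ∧ g = 1 ∨
            I.group a e l = g ∧ g = 3 ∧ ¬ I.IsEnd (e + 1) l := by
      intro g
      rw [List.filter_filter]
      congr 1
      funext l
      have := I.left_lt_right l
      rw [← Bool.decide_and, decide_eq_decide]
      unfold group IsEnd
      cases a.right l <;> simp <;> split_ifs <;> omega
    simp only [keyLayout, farLines, List.range_succ, List.range_zero, List.nil_append,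
      List.flatMap_append, List.flatMap_cons, List.flatMap_nil, List.append_nil,
      List.filter_append, h]
    simp
  have hnear : ((I.keyLayout a).near (e + 1)).filter (fun l => ¬ I.IsEnd (e + 1) l) =
      (I.sortedLines a).filter fun l => I.group a e l = 1 := by
    simp only [keyLayout]
    rw [List.filter_filter]
    congr 1
    funext l
    have := I.left_lt_right l
    rw [← Bool.decide_and, decide_eq_decide, group_lt_three, group_eq_one]
    unfold IsEnd OnEdge
    omega
  exact ⟨hfar.trans hnear.symm ▸ List.filter_sublist,
    hnear.trans hfar.symm ▸ List.filter_sublist⟩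

theorem keyLayout_respects (I : MetroPath) (a : Assignment I) : (I.keyLayout a).Respects a := by
  intro l
  have hl := I.left_lt_right l
  have hn := I.right_le l
  have h₁ : I.OnEdge (I.left l) l := ⟨le_rfl, hl⟩
  have h₂ : I.OnEdge (I.right l - 1) l := ⟨by omega, by omega⟩
  constructor
  · intro l' hl' hne
    have h' : I.OnEdge (I.left l) l' := ((I.keyLayout a).mem_near _ _).1 hl'
    have := I.right_le l'
    have := I.one_le_left l
    have := I.one_le_left l'
    split_ifs with hb
    · refine below_near_of_before h' h₁ (Or.inl ?_)
      have hne' : a.left l' = true → I.left l' ≠ I.left l := fun h h'' => hne ⟨h'', h.trans hb.symm⟩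
      unfold OnEdge at h'
      unfold startKey
      rw [if_pos hb]
      split_ifs with hb'
      · have := hne' hb'; omega
      · omega
    · refine below_near_of_before h₁ h' (Or.inl ?_)
      have hne' : ¬ a.left l' = true → I.left l' ≠ I.left l := fun h h'' =>
        hne ⟨h'', by simp at h hb; simp [h, hb]⟩
      unfold OnEdge at h'
      unfold startKey
      rw [if_neg hb]
      split_ifs with hb'
      · omega
      · have := hne' hb'; omega
  · intro l' hl' hne
    have h' : I.OnEdge (I.right l - 1) l' := ((I.keyLayout a).mem_far _ _).1 hl'
    have h'' := h'
    unfold OnEdge at h''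
    have hg : I.group a (I.right l - 1) l = (a.right l).toNat + (a.right l).toNat := by
      unfold group; rw [if_neg (by omega), if_pos (by omega), if_neg (by omega)]
    have hg' : I.group a (I.right l - 1) l' = 1 ∨
        I.right l' = I.right l ∧
        I.group a (I.right l - 1) l' = (a.right l').toNat + (a.right l').toNat := by
      unfold group; rw [if_neg (by omega), if_pos (by omega)]
      split_ifs <;> omega
    split_ifs with hb
    · refine below_far_of_beforeFar h' h₂ (Or.inl ?_)
      rw [hg, hb]
      rcases hg' with h | ⟨h, h'⟩
      · simp [h]
      · cases hb' : a.right l' <;> simp_all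
    · refine below_far_of_beforeFar h₂ h' (Or.inl ?_)
      simp only [Bool.not_eq_true] at hb
      rw [hg, hb]
      rcases hg' with h | ⟨h, h'⟩
      · simp [h]
      · cases hb' : a.right l' <;> simp_all

/-- A crossing of the key layout takes place where the first of the two lines ends, and it is
forced by the assignment at both ends of the common part of the two lines. -/
theorem crossing_keyLayout {I : MetroPath} {a : Assignment I} {e : ℕ} {p q : Fin I.k}
    (h₁ : Below ((I.keyLayout a).near e) p q) (h₂ : Below ((I.keyLayout a).far e) q p) :
    e + 1 = min (I.right p) (I.right q) ∧ I.startKey a.left p < I.startKey a.left q ∧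
      I.group a e q < I.group a e p := by
  have hp : I.OnEdge e p := ((I.keyLayout a).mem_near _ _).1 h₁.1
  have hq : I.OnEdge e q := ((I.keyLayout a).mem_near _ _).1 h₁.2.1
  have hb := h₁.before
  have hg : I.group a e q < I.group a e p :=
    h₂.beforeFar.resolve_right fun h => hb.asymm h.2
  have hne : p ≠ q := by rintro rfl; exact h₁.asymm h₁
  have := I.right_le p
  have := I.right_le q
  have hg' := hg
  rw [group_of_onEdge a hp, group_of_onEdge a hq] at hg'
  unfold OnEdge at hp hq
  have he : e + 1 = min (I.right p) (I.right q) := by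
    split_ifs at hg' <;> omega
  refine ⟨he, hb.resolve_right ?_, hg⟩
  rintro ⟨h, h'⟩
  -- Lines starting together on one side are sorted so that they need not cross.
  have hl := left_eq_of_startKey_eq h
  have hr : I.right p ≠ I.right q := fun hr => hne (I.distinct _ _ hl.1 hr)
  unfold endKey at h'
  cases hp' : a.right p <;> cases hq' : a.right q <;>
    simp only [hp', hq', Bool.toNat_false, Bool.toNat_true, if_true, Bool.false_eq_true,
      if_false] at hg' h' <;>
    split_ifs at hg' <;> omega

theorem crossings_keyLayout (I : MetroPath) (a : Assignment I) :
    (I.keyLayout a).crossings = (I.keyLayout a).crossingPairs.card := by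
  unfold Layout.crossings Layout.crossingPairs
  rw [Finset.card_biUnion]
  intro e _ e' _ hne
  rw [Function.onFun, Finset.disjoint_left]
  intro p hp hp'
  simp only [Finset.mem_filter, Finset.mem_univ, true_and] at hp hp'
  have h := (crossing_keyLayout hp.1 hp.2).1
  have h' := (crossing_keyLayout hp'.1 hp'.2).1
  omega

/-- Each crossing of the key layout is forced, so its two lines cross in every layout that respects
the assignment. -/
theorem keyLayout_solvesPA (I : MetroPath) (a : Assignment I) : (I.keyLayout a).SolvesPA a := by
  refine ⟨I.keyLayout_admissible a, I.keyLayout_respects a, fun Λ hΛ hr => ?_⟩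
  rw [crossings_keyLayout]
  refine (Finset.card_le_card ?_).trans Λ.card_crossingPairs_le
  rintro ⟨p, q⟩ h
  obtain ⟨e, h₁, h₂⟩ := Layout.mem_crossingPairs.1 h
  have hp : I.OnEdge e p := ((I.keyLayout a).mem_near _ _).1 h₁.1
  have hq : I.OnEdge e q := ((I.keyLayout a).mem_near _ _).1 h₁.2.1
  obtain ⟨he, hk, hg⟩ := crossing_keyLayout h₁ h₂
  refine hΛ.mem_crossingPairs (max_le hp.1 hq.1) (hr.below_near ?_ ?_ hk)
    (hr.below_far hq hp hg) <;> unfold OnEdge at hp hq <;> omega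

/-! ### Optimal right ends for given left ends -/

/-- The number of lines that pass through the right end of `i` and have to lie below `i` if the
left ends are drawn as in `α`. -/
def numBelow (I : MetroPath) (α : Fin I.k → Bool) (i : Fin I.k) : ℕ :=
  (Finset.univ.filter fun p => (I.left p < I.right i ∧ I.right i < I.right p) ∧
    I.startKey α p < I.startKey α i).card

/-- The number of lines that pass through the right end of `i` and have to lie above `i` if the
left ends are drawn as in `α`. -/
def numAbove (I : MetroPath) (α : Fin I.k → Bool) (i : Fin I.k) : ℕ :=
  (Finset.univ.filter fun p => (I.left p < I.right i ∧ I.right i < I.right p) ∧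
    I.startKey α i < I.startKey α p).card

/-- The assignment that completes `α` by drawing each right end on the side where the line has
fewer lines to cross. -/
def complete (I : MetroPath) (α : Fin I.k → Bool) : Assignment I where
  left := α
  right i := decide (I.numAbove α i ≤ I.numBelow α i)

/-- The minimum number of crossings if the left ends are drawn as in `α`. -/
def minCrossings (I : MetroPath) (α : Fin I.k → Bool) : ℕ :=
  ∑ i, min (I.numBelow α i) (I.numAbove α i)

/-- The pairs `(i, p)` where `p` passes through the right end of `i` and the assignment forces the
two to cross. -/
def forcedPairs (I : MetroPath) (a : Assignment I) : Finset (Fin I.k × Fin I.k) :=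
  Finset.univ.filter fun x => (I.left x.2 < I.right x.1 ∧ I.right x.1 < I.right x.2) ∧
    if a.right x.1 then I.startKey a.left x.1 < I.startKey a.left x.2
    else I.startKey a.left x.2 < I.startKey a.left x.1

theorem card_forcedPairs (I : MetroPath) (a : Assignment I) : (I.forcedPairs a).card =
    ∑ i, if a.right i then I.numAbove a.left i else I.numBelow a.left i := by
  unfold forcedPairs
  rw [Finset.card_filter, ← Finset.univ_product_univ, Finset.sum_product]
  refine Finset.sum_congr rfl fun i _ => ?_
  rw [← Finset.card_filter]
  cases h : a.right i <;> simp [numAbove, numBelow, h]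

/-- Each line `i` crosses the lines that lie between it and the side of its right end. Every crossing
is counted for the line that ends first. -/
theorem card_forcedPairs_le {I : MetroPath} {a : Assignment I} {Λ : Layout I}
    (hΛ : Λ.Admissible) (hr : Λ.Respects a) : (I.forcedPairs a).card ≤ Λ.crossings := by
  refine le_trans ?_ Λ.card_crossingPairs_le
  refine Finset.card_le_card_of_injOn (fun x => if a.right x.1 then x else x.swap) ?_ ?_
  · rintro ⟨i, p⟩ h
    simp only [forcedPairs, Finset.coe_filter, Finset.mem_univ, true_and, Set.mem_ofPred_eq] at h
    obtain ⟨⟨h₁, h₂⟩, h₃⟩ := h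
    have := I.left_lt_right i
    have hi : I.OnEdge (I.right i - 1) i := ⟨by omega, by omega⟩
    have hp : I.OnEdge (I.right i - 1) p := ⟨by omega, by omega⟩
    have hgi : I.group a (I.right i - 1) i = (a.right i).toNat + (a.right i).toNat := by
      unfold group; rw [if_neg (by omega), if_pos (by omega), if_neg (by omega)]
    have hgp : I.group a (I.right i - 1) p = 1 := by
      unfold group; rw [if_neg (by omega), if_pos (by omega), if_pos (by omega)]
    cases hb : a.right i
    · simp only [hb, Bool.false_eq_true, if_false] at h₃
      simp only [hb, Bool.false_eq_true, if_false, Prod.swap_prod_mk, Finset.mem_coe]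
      refine hΛ.mem_crossingPairs (e₂ := I.right i - 1) ?_
        (hr.below_near (by omega) (by omega) h₃) (hr.below_far hi hp ?_)
      · omega
      · simp [hgi, hgp, hb]
    · simp only [hb, if_true] at h₃
      simp only [hb, if_true, Finset.mem_coe]
      refine hΛ.mem_crossingPairs (e₂ := I.right i - 1) ?_
        (hr.below_near (by omega) (by omega) h₃) (hr.below_far hp hi ?_)
      · omega
      · simp [hgi, hgp, hb]
  · -- Orientation is recovered from the right ends.
    rintro ⟨i, p⟩ h ⟨i', p'⟩ h' heq
    simp only [forcedPairs, Finset.coe_filter, Finset.mem_univ, true_and, Set.mem_ofPred_eq] at h h'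
    dsimp only at heq
    split_ifs at heq <;> simp only [Prod.swap_prod_mk, Prod.mk.injEq] at heq ⊢ <;>
      obtain ⟨rfl, rfl⟩ := heq <;> first | exact ⟨rfl, rfl⟩ | omega

theorem minCrossings_le {I : MetroPath} {a : Assignment I} {Λ : Layout I}
    (hΛ : Λ.Admissible) (hr : Λ.Respects a) : I.minCrossings a.left ≤ Λ.crossings := by
  refine le_trans ?_ (card_forcedPairs_le hΛ hr)
  rw [card_forcedPairs]
  refine Finset.sum_le_sum fun i _ => ?_
  split_ifs
  · exact min_le_right _ _
  · exact min_le_left _ _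

/-- With the right ends drawn by majority, lines that end at the same station do not cross: of two
such lines the upper one has more lines below it and fewer above it. -/
theorem crossings_keyLayout_complete_le (I : MetroPath) (α : Fin I.k → Bool) :
    (I.keyLayout (I.complete α)).crossings ≤ I.minCrossings α := by
  have hcard : (I.forcedPairs (I.complete α)).card = I.minCrossings α := by
    rw [card_forcedPairs]
    refine Finset.sum_congr rfl fun i _ => ?_
    simp only [complete, decide_eq_true_eq]
    split_ifs with h
    · exact (min_eq_right h).symm
    · exact (min_eq_left (by omega)).symm
  rw [crossings_keyLayout, ← hcard]
  refine le_trans (Finset.card_le_card ?_) (Finset.card_image_le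
    (f := fun x => if (I.complete α).right x.1 then x else x.swap))
  rintro ⟨p, q⟩ h
  obtain ⟨e, h₁, h₂⟩ := Layout.mem_crossingPairs.1 h
  have hp : I.OnEdge e p := ((I.keyLayout _).mem_near _ _).1 h₁.1
  have hq : I.OnEdge e q := ((I.keyLayout _).mem_near _ _).1 h₁.2.1
  obtain ⟨he, hk, hg⟩ := crossing_keyLayout h₁ h₂
  rw [group_of_onEdge _ hp, group_of_onEdge _ hq] at hg
  unfold OnEdge at hp hq
  rw [Finset.mem_image]
  rcases lt_trichotomy (I.right p) (I.right q) with hr | hr | hr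
  · have hb : (I.complete α).right p = true := by
      rw [if_pos (by omega), if_neg (by omega)] at hg
      cases hb : (I.complete α).right p
      · simp [hb] at hg
      · rfl
    refine ⟨(p, q), ?_, by simp [hb]⟩
    simp only [forcedPairs, Finset.mem_filter, Finset.mem_univ, true_and, hb, if_true]
    exact ⟨⟨by omega, hr⟩, hk⟩
  · exfalso
    rw [if_neg (by omega), if_neg (by omega)] at hg
    have hbp : (I.complete α).right p = true := by
      cases hb : (I.complete α).right p
      · simp [hb] at hg
      · rfl
    have hbq : ¬ (I.complete α).right q = true := by
      intro hb; simp [hb, hbp] at hg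
    simp only [complete, decide_eq_true_eq] at hbp hbq hk
    have hB : I.numBelow α p ≤ I.numBelow α q := by
      refine Finset.card_le_card fun x => ?_
      simp only [Finset.mem_filter, Finset.mem_univ, true_and, hr]
      exact fun h => ⟨h.1, h.2.trans hk⟩
    have hA : I.numAbove α q ≤ I.numAbove α p := by
      refine Finset.card_le_card fun x => ?_
      simp only [Finset.mem_filter, Finset.mem_univ, true_and, hr]
      exact fun h => ⟨h.1, hk.trans h.2⟩
    omega
  · have hb : (I.complete α).right q = false := by
      rw [if_neg (by omega), if_pos (by omega)] at hg
      cases hb : (I.complete α).right q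
      · rfl
      · simp [hb] at hg
    refine ⟨(q, p), ?_, by simp [hb]⟩
    simp only [forcedPairs, Finset.mem_filter, Finset.mem_univ, true_and, hb, Bool.false_eq_true,
      if_false]
    exact ⟨⟨by omega, hr⟩, hk⟩

theorem Layout.Respects.periphery {I : MetroPath} {a : Assignment I} {Λ : Layout I}
    (h : Λ.Respects a) : Λ.Periphery := by
  intro l
  constructor
  · cases hb : a.left l
    · refine Or.inl fun l' hl' hne => ?_
      simpa [hb] using (h l).1 l' hl' fun h' => hne (Or.inl h'.1)
    · refine Or.inr fun l' hl' hne => ?_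
      simpa [hb] using (h l).1 l' hl' fun h' => hne (Or.inl h'.1)
  · cases hb : a.right l
    · refine Or.inl fun l' hl' hne => ?_
      simpa [hb] using (h l).2 l' hl' fun h' => hne (Or.inr h'.1)
    · refine Or.inr fun l' hl' hne => ?_
      simpa [hb] using (h l).2 l' hl' fun h' => hne (Or.inr h'.1)

/-- Two ends at the same station that are drawn on different sides are separated by a line that
does not end there. -/
theorem Layout.AtVerge.below {I : MetroPath} {v : ℕ} {s : List (Fin I.k)} {l l' : Fin I.k}
    (hl : AtVerge I v s l) (hl' : I.IsEnd v l' → AtVerge I v s l') (hmem : l' ∈ s)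
    (hne : ¬ (I.IsEnd v l' ∧ ((∀ x ∈ s, ¬ I.IsEnd v x → Below s x l') ↔
      ∀ x ∈ s, ¬ I.IsEnd v x → Below s x l))) :
    ((∀ x ∈ s, ¬ I.IsEnd v x → Below s x l) → Below s l' l) ∧
      (¬ (∀ x ∈ s, ¬ I.IsEnd v x → Below s x l) → Below s l l') := by
  constructor
  · intro ht
    by_cases he : I.IsEnd v l'
    · have hnt : ¬ ∀ x ∈ s, ¬ I.IsEnd v x → Below s x l' := fun h => hne ⟨he, iff_of_true h ht⟩
      have hb := (hl' he).resolve_right hnt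
      push Not at hnt
      obtain ⟨x, hx, hxe, -⟩ := hnt
      exact (hb x hx hxe).trans (ht x hx hxe)
    · exact ht l' hmem he
  · intro hnt
    have hb := hl.resolve_right hnt
    by_cases he : I.IsEnd v l'
    · have ht : ∀ x ∈ s, ¬ I.IsEnd v x → Below s x l' := by
        by_contra h
        exact hne ⟨he, iff_of_false h hnt⟩
      push Not at hnt
      obtain ⟨x, hx, hxe, -⟩ := hnt
      exact (hb x hx hxe).trans (ht x hx hxe)
    · exact hb l' hmem he

theorem Layout.Periphery.exists_respects {I : MetroPath} {Λ : Layout I} (h : Λ.Periphery) :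
    ∃ a : Assignment I, Λ.Respects a := by
  refine ⟨⟨fun l => decide (∀ l' ∈ Λ.near (I.left l), ¬ I.IsEnd (I.left l) l' →
      Below (Λ.near (I.left l)) l' l),
    fun l => decide (∀ l' ∈ Λ.far (I.right l - 1), ¬ I.IsEnd (I.right l) l' →
      Below (Λ.far (I.right l - 1)) l' l)⟩, fun l => ⟨fun l' hl' hne => ?_, fun l' hl' hne => ?_⟩⟩
  · simp only [decide_eq_true_eq, decide_eq_decide] at hne ⊢
    have hon := (Λ.mem_near _ _).1 hl'
    have heq : I.IsEnd (I.left l) l' → I.left l' = I.left l := by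
      unfold OnEdge at hon; unfold IsEnd; omega
    have hb := Layout.AtVerge.below (h l).1 (fun he => by simpa only [heq he] using (h l').1) hl' fun hc =>
      hne ⟨heq hc.1, by simpa only [heq hc.1] using hc.2⟩
    split_ifs with ht
    · exact hb.1 ht
    · exact hb.2 ht
  · simp only [decide_eq_true_eq, decide_eq_decide] at hne ⊢
    have hon := (Λ.mem_far _ _).1 hl'
    have heq : I.IsEnd (I.right l) l' → I.right l' = I.right l := by
      have := I.left_lt_right l
      unfold OnEdge at hon; unfold IsEnd; omega
    have hb := Layout.AtVerge.below (h l).2 (fun he => by simpa only [heq he] using (h l').2) hl' fun hc =>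
      hne ⟨heq hc.1, by simpa only [heq hc.1] using hc.2⟩
    split_ifs with ht
    · exact hb.1 ht
    · exact hb.2 ht

end MetroPath

/-! ### Reasoning about programs -/

namespace RAM

/-- The state with the value of register `r` changed to `v`. -/
def State.setReg (s : State) (r v : ℕ) : State := { s with reg := Function.update s.reg r v }

/-- The state with the content of memory cell `a` changed to `v`. -/
def State.setMem (s : State) (a v : ℕ) : State := { s with mem := Function.update s.mem a v }

theorem State.reg_setReg (s : State) (r v q : ℕ) :
    (s.setReg r v).reg q = if q = r then v else s.reg q := Function.update_apply _ _ _ _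

theorem State.mem_setReg (s : State) (r v : ℕ) : (s.setReg r v).mem = s.mem := rfl

theorem State.mem_setMem (s : State) (a v b : ℕ) :
    (s.setMem a v).mem b = if b = a then v else s.mem b := Function.update_apply _ _ _ _

theorem State.reg_setMem (s : State) (a v : ℕ) : (s.setMem a v).reg = s.reg := rfl

/-- Started in state `s`, the program halts after some number `t` of steps in some state `s'` for
which `Q s' t` holds. -/
def WP (W : ℕ) (P : Program) (Q : State → ℕ → Prop) (s : State) : Prop :=
  ∃ s' t, Exec W P s s' t ∧ Q s' t

variable {W : ℕ} {Q Q' : State → ℕ → Prop} {s : State}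

theorem WP.mono {P : Program} (h : WP W P Q s) (hQ : ∀ s' t, Q s' t → Q' s' t) : WP W P Q' s :=
  let ⟨s', t, h₁, h₂⟩ := h
  ⟨s', t, h₁, hQ s' t h₂⟩

theorem wp_skip : WP W .skip Q s ↔ Q s 1 :=
  ⟨fun ⟨_, _, h, hQ⟩ => by cases h; exact hQ, fun h => ⟨_, _, .skip s, h⟩⟩

theorem wp_assign {r : ℕ} {e : Expr} : WP W (.assign r e) Q s ↔
    e.Fits W s ∧ Q (s.setReg r (e.eval s)) (e.cost + 1) :=
  ⟨fun ⟨_, _, h, hQ⟩ => by cases h with | assign _ _ _ he => exact ⟨he, hQ⟩,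
    fun h => ⟨_, _, .assign s r e h.1, h.2⟩⟩

theorem wp_store {a e : Expr} : WP W (.store a e) Q s ↔
    (a.Fits W s ∧ e.Fits W s) ∧
      Q (s.setMem (a.eval s) (e.eval s)) (a.cost + e.cost + 1) :=
  ⟨fun ⟨_, _, h, hQ⟩ => by cases h with | store _ _ _ ha he => exact ⟨⟨ha, he⟩, hQ⟩,
    fun h => ⟨_, _, .store s a e h.1.1 h.1.2, h.2⟩⟩

theorem wp_seq {c d : Program} : WP W (.seq c d) Q s ↔
    WP W c (fun s₁ t₁ => WP W d (fun s₂ t₂ => Q s₂ (t₁ + t₂)) s₁) s :=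
  ⟨fun ⟨_, _, h, hQ⟩ => by cases h with | seq h₁ h₂ => exact ⟨_, _, h₁, _, _, h₂, hQ⟩,
    fun ⟨_, _, h₁, _, _, h₂, hQ⟩ => ⟨_, _, .seq h₁ h₂, hQ⟩⟩

theorem wp_branch {x y : Expr} {c d : Program} : WP W (.branch x y c d) Q s ↔
    (x.Fits W s ∧ y.Fits W s) ∧
      (x.eval s < y.eval s → WP W c (fun s' t => Q s' (x.cost + y.cost + 1 + t)) s) ∧
      (¬ x.eval s < y.eval s → WP W d (fun s' t => Q s' (x.cost + y.cost + 1 + t)) s) := by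
  constructor
  · rintro ⟨_, _, h, hQ⟩
    cases h with
    | branch_true hx hy hlt h => exact ⟨⟨hx, hy⟩, fun _ => ⟨_, _, h, hQ⟩, fun hn => absurd hlt hn⟩
    | branch_false hx hy hge h =>
      exact ⟨⟨hx, hy⟩, fun hlt => absurd hlt hge.not_gt, fun _ => ⟨_, _, h, hQ⟩⟩
  · rintro ⟨⟨hx, hy⟩, ht, hf⟩
    by_cases hlt : x.eval s < y.eval s
    · obtain ⟨_, _, h, hQ⟩ := ht hlt
      exact ⟨_, _, .branch_true hx hy hlt h, hQ⟩
    · obtain ⟨_, _, h, hQ⟩ := hf hlt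
      exact ⟨_, _, .branch_false hx hy (not_lt.1 hlt) h, hQ⟩

/-- A loop that runs exactly `M` times, with an invariant indexed by the number of rounds. -/
theorem wp_loop {x y : Expr} {c : Program} (M T : ℕ) (Inv : ℕ → State → Prop)
    (hcond : ∀ m s, m ≤ M → Inv m s →
      (x.Fits W s ∧ y.Fits W s) ∧ (x.eval s < y.eval s ↔ m < M))
    (hstep : ∀ m s, m < M → Inv m s → WP W c (fun s' t => Inv (m + 1) s' ∧ t ≤ T) s)
    (h₀ : Inv 0 s)
    (hQ : ∀ s' t, Inv M s' → t ≤ M * (x.cost + y.cost + 1 + T) + (x.cost + y.cost + 1) → Q s' t) :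
    WP W (.loop x y c) Q s := by
  have key : ∀ j m s, m + j = M → Inv m s → WP W (.loop x y c)
      (fun s' t => Inv M s' ∧ t ≤ j * (x.cost + y.cost + 1 + T) + (x.cost + y.cost + 1)) s := by
    intro j
    induction j with
    | zero =>
      intro m s hm hI
      obtain ⟨⟨hx, hy⟩, hlt⟩ := hcond m s (by omega) hI
      have hm' : m = M := by omega
      subst hm'
      exact ⟨_, _, Exec.loop_stop hx hy (not_lt.1 fun h => lt_irrefl _ (hlt.1 h)), hI, by omega⟩
    | succ j ih =>
      intro m s hm hI
      obtain ⟨⟨hx, hy⟩, hlt⟩ := hcond m s (by omega) hI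
      obtain ⟨s₁, t₁, h₁, hI₁, ht₁⟩ := hstep m s (by omega) hI
      obtain ⟨s₂, t₂, h₂, hI₂, ht₂⟩ := ih (m + 1) s₁ (by omega) hI₁
      refine ⟨_, _, .loop_step hx hy (hlt.2 (by omega)) h₁ h₂, hI₂, ?_⟩
      rw [Nat.succ_mul]; omega
  exact (key M 0 s (by omega) h₀).mono fun s' t h => hQ s' t h.1 h.2

theorem Expr.Fits.mono {W W' : ℕ} (hW : W ≤ W') {s : State} {e : Expr} (h : e.Fits W s) :
    e.Fits W' s := by
  induction e with
  | const c => exact le_trans h hW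
  | reg r => exact le_trans h hW
  | load a iha => exact ⟨iha h.1, h.2.trans hW⟩
  | add a b iha ihb => exact ⟨iha h.1, ihb h.2.1, h.2.2.trans hW⟩
  | sub a b iha ihb => exact ⟨iha h.1, ihb h.2⟩

theorem Exec.mono {W W' : ℕ} (hW : W ≤ W') {P : Program} {s s' : State} {t : ℕ}
    (h : Exec W P s s' t) : Exec W' P s s' t := by
  induction h with
  | skip s => exact .skip s
  | assign s r e he => exact .assign s r e (he.mono hW)
  | store s a e ha he => exact .store s a e (ha.mono hW) (he.mono hW)
  | seq _ _ ih₁ ih₂ => exact .seq ih₁ ih₂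
  | branch_true hx hy hlt _ ih => exact .branch_true (hx.mono hW) (hy.mono hW) hlt ih
  | branch_false hx hy hge _ ih => exact .branch_false (hx.mono hW) (hy.mono hW) hge ih
  | loop_stop hx hy hge => exact Exec.loop_stop (hx.mono hW) (hy.mono hW) hge
  | loop_step hx hy hlt _ _ ih₁ ih₂ => exact .loop_step (hx.mono hW) (hy.mono hW) hlt ih₁ ih₂

theorem Computes.mono {W W' T T' : ℕ} {P : Program} {x y : List ℕ} (h : Computes W T P x y)
    (hW : W ≤ W') (hT : T ≤ T') : Computes W' T' P x y := fun s hs =>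
  let ⟨s', t, h₁, h₂, h₃⟩ := h s hs
  ⟨s', t, h₁.mono hW, h₂.trans hT, h₃⟩

theorem Computes.seq {W T₁ T₂ : ℕ} {P₁ P₂ : Program} {x y z : List ℕ}
    (h₁ : Computes W T₁ P₁ x y) (h₂ : Computes W T₂ P₂ y z) :
    Computes W (T₁ + T₂) (P₁.seq P₂) x z := fun s hs =>
  let ⟨_, _, e₁, b₁, hy⟩ := h₁ s hs
  let ⟨s₂, _, e₂, b₂, hz⟩ := h₂ _ hy
  ⟨s₂, _, .seq e₁ e₂, add_le_add b₁ b₂, hz⟩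

end RAM

theorem List.getElem?_flatMap_pair {α β : Type*} (L : List α) (f g : α → β) (i : ℕ) :
    (L.flatMap fun x => [f x, g x])[i + i]? = L[i]?.map f ∧
      (L.flatMap fun x => [f x, g x])[i + i + 1]? = L[i]?.map g := by
  induction L generalizing i with
  | nil => simp
  | cons x L ih =>
    cases i with
    | zero => simp
    | succ i =>
      have h : i + 1 + (i + 1) = i + i + 1 + 1 := by omega
      simpa [h] using ih i

theorem List.length_flatMap_pair {α β : Type*} (L : List α) (f g : α → β) :
    (L.flatMap fun x => [f x, g x]).length = L.length + L.length := by
  induction L with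
  | nil => simp
  | cons x L ih => simp [ih]; omega

namespace MetroPath

open RAM

theorem holds_iff (s : State) (x : List ℕ) :
    Holds s x ↔ ∀ i v, x[i]? = some v → s.mem i = v := by
  unfold Holds
  constructor
  · intro h i v hv
    obtain ⟨hi, rfl⟩ := List.getElem?_eq_some_iff.1 hv
    exact h i hi
  · intro h i hi
    exact h i _ (List.getElem?_eq_getElem hi)

/-- The cells from address `b` on hold the encoding of `I`. -/
def InputAt (I : MetroPath) (m : ℕ → ℕ) (b : ℕ) : Prop :=
  m b = I.n ∧ m (b + 1) = I.k ∧
    ∀ l : Fin I.k, m (b + (2 + (l + l))) = I.left l ∧ m (b + (3 + (l + l))) = I.right l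

/-- The cells from address `b` on hold the encoding of `a`. -/
def AssignmentAt {I : MetroPath} (a : Assignment I) (m : ℕ → ℕ) (b : ℕ) : Prop :=
  ∀ l : Fin I.k, m (b + (l + l)) = (a.left l).toNat ∧ m (b + (l + l + 1)) = (a.right l).toNat

/-- The list `f 0, g 0, f 1, g 1, …` is in memory from address `b` on if and only if each `f l` is
in cell `b + 2 * l` and each `g l` in the cell after it. -/
theorem forall_getElem?_flatMap_pair {k : ℕ} (f g : Fin k → ℕ) (m : ℕ → ℕ) (b : ℕ) :
    (∀ i v, ((List.finRange k).flatMap fun l => [f l, g l])[i]? = some v → m (b + i) = v) ↔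
      ∀ l : Fin k, m (b + (l + l)) = f l ∧ m (b + (l + l + 1)) = g l := by
  constructor
  · intro h l
    have := List.getElem?_flatMap_pair (List.finRange k) f g l
    exact ⟨h _ _ (by rw [this.1]; simp), h _ _ (by rw [this.2]; simp)⟩
  · intro h i v hv
    obtain ⟨hi, -⟩ := List.getElem?_eq_some_iff.1 hv
    rw [List.length_flatMap_pair, List.length_finRange] at hi
    rcases Nat.even_or_odd' i with ⟨j, rfl | rfl⟩
    · have hj : j < k := by omega
      have := (List.getElem?_flatMap_pair (List.finRange k) f g j).1
      rw [two_mul] at hv ⊢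
      rw [this] at hv
      simp [hj] at hv
      rw [← hv]; exact (h ⟨j, hj⟩).1
    · have hj : j < k := by omega
      have := (List.getElem?_flatMap_pair (List.finRange k) f g j).2
      rw [two_mul] at hv ⊢
      rw [this] at hv
      simp [hj] at hv
      rw [← hv]; exact (h ⟨j, hj⟩).2

theorem length_encode (I : MetroPath) : I.encode.length = 2 + I.k + I.k := by
  simp [encode]; omega

theorem Assignment.length_encode {I : MetroPath} (a : Assignment I) :
    a.encode.length = I.k + I.k := by
  simp [Assignment.encode]; omega

theorem holds_encode_iff (I : MetroPath) (s : State) :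
    Holds s I.encode ↔ I.InputAt s.mem 0 := by
  have h := forall_getElem?_flatMap_pair I.left I.right s.mem 2
  rw [holds_iff, InputAt, encode]
  constructor
  · intro H
    refine ⟨H 0 _ rfl, H 1 _ rfl, fun l => ?_⟩
    have := h.1 (fun i v hv => by
      rw [add_comm]; exact H (i + 1 + 1) v (by simpa using hv)) l
    refine ⟨?_, ?_⟩
    · rw [← this.1]; congr 1; omega
    · rw [← this.2]; congr 1; omega
  · rintro ⟨h₀, h₁, H⟩ i v hv
    match i with
    | 0 => simpa [h₀] using hv
    | 1 => simpa [h₁] using hv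
    | i + 2 =>
      rw [add_comm]
      refine h.2 (fun l => ⟨?_, ?_⟩) i v (by simpa using hv)
      · rw [← (H l).1]; congr 1; omega
      · rw [← (H l).2]; congr 1; omega

theorem holds_append_iff {I : MetroPath} (a : Assignment I) (s : State) :
    Holds s (I.encode ++ a.encode) ↔
      I.InputAt s.mem 0 ∧ AssignmentAt a s.mem (2 + I.k + I.k) := by
  rw [← holds_encode_iff, holds_iff, holds_iff]
  have h := forall_getElem?_flatMap_pair (fun l => (a.left l).toNat) (fun l => (a.right l).toNat)
    s.mem (2 + I.k + I.k)
  rw [AssignmentAt, ← h]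
  constructor
  · refine fun H => ⟨fun i v hv => H i v ?_, fun i v hv => H _ v ?_⟩
    · rw [List.getElem?_append_left, hv]
      exact (List.getElem?_eq_some_iff.1 hv).1
    · rw [List.getElem?_append_right (by rw [length_encode]; omega), length_encode]
      simpa [Assignment.encode] using hv
  · rintro ⟨H₁, H₂⟩ i v hv
    by_cases hi : i < I.encode.length
    · exact H₁ i v (by rwa [List.getElem?_append_left hi] at hv)
    · rw [List.getElem?_append_right (by omega), length_encode] at hv
      rw [length_encode] at hi
      have := H₂ (i - (2 + I.k + I.k)) v hv
      rw [← this]; congr 1; omega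

end MetroPath

/-! ### The program for optimal assignments -/

namespace RAM.Expr

attribute [simp] eval Fits cost

/-- The left end of the line whose number is in register `r`, with the input at address `0`. -/
abbrev leftEnd (r : ℕ) : Expr := load (add (const 2) (add (reg r) (reg r)))

/-- The right end of the line whose number is in register `r`, with the input at address `0`. -/
abbrev rightEnd (r : ℕ) : Expr := load (add (const 3) (add (reg r) (reg r)))

/-- The cell with the index in register `r` of the array that starts at the address in
register `b`. -/
abbrev cell (b r : ℕ) : Expr := load (add (reg b) (reg r))

/-- The number of stations. -/
abbrev numStations : Expr := load (const 0)

/-- The number of lines. -/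
abbrev numLines : Expr := load (const 1)

end RAM.Expr

namespace RAM.Program

open RAM.Expr

/-- Adds one to register `r`. -/
abbrev incr (r : ℕ) : Program := assign r (add (reg r) (const 1))

/-- Writes into register `d` the key of the line whose number is in register `r`. -/
def computeKey (d r : ℕ) : Program :=
  branch (cell 1 r) (const 1) (assign d (sub numStations (leftEnd r)))
    (assign d (add numStations (leftEnd r)))

/-- Counts in registers `7` and `8` the lines that pass through the right end of line number
`reg 5` and lie below or above that line. -/
def countSides : Program :=
  (computeKey 6 5).seq <| (assign 7 (const 0)).seq <| (assign 8 (const 0)).seq <|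
  (assign 9 (const 0)).seq <| loop (reg 9) numLines <| (computeKey 10 9).seq <|
  (branch (leftEnd 9) (rightEnd 5)
    (branch (rightEnd 5) (rightEnd 9)
      (branch (reg 10) (reg 6) (incr 7) (branch (reg 6) (reg 10) (incr 8) skip)) skip) skip).seq
  (incr 9)

/-- Determines the best right ends for the current left ends and, in register `4`, how many
crossings fewer than `k * k` they need. -/
def evaluate : Program :=
  (assign 4 (const 0)).seq <| (assign 5 (const 0)).seq <| loop (reg 5) numLines <|
  countSides.seq <|
  (branch (reg 7) (reg 8)
    ((store (add (reg 2) (reg 5)) (const 0)).seq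
      (assign 4 (add (reg 4) (sub numLines (reg 7)))))
    ((store (add (reg 2) (reg 5)) (const 1)).seq
      (assign 4 (add (reg 4) (sub numLines (reg 8)))))).seq
  (incr 5)

/-- Saves the current assignment if it is at least as good as the one saved before. -/
def save : Program :=
  branch (reg 4) (reg 3) skip <| (assign 3 (reg 4)).seq <| (assign 11 (const 0)).seq <|
  loop (reg 11) numLines <|
  (store (add (reg 0) (add (reg 11) (reg 11))) (cell 1 11)).seq <|
  (store (add (reg 0) (add (add (reg 11) (reg 11)) (const 1))) (cell 2 11)).seq (incr 11)

/-- Adds one to the number whose binary digits give the current left ends. -/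
def increment : Program :=
  (assign 12 (const 1)).seq <| (assign 11 (const 0)).seq <|
  loop (reg 11) (add numLines (const 1)) <|
  (branch (cell 1 11) (reg 12)
    ((store (add (reg 1) (reg 11)) (const 1)).seq (assign 12 (const 0)))
    (store (add (reg 1) (reg 11)) (sub (cell 1 11) (reg 12)))).seq (incr 11)

/-- Computes an optimal assignment by going through all choices of left ends. These are the digits
of a binary counter with `k + 1` digits, and the search is over when the leading one becomes `1`.
Registers `0`, `1` and `2` hold the addresses of the best assignment so far, of the counter, and of
the right ends that belong to it; register `3` holds the value of the best assignment. -/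
def findAssignment : Program :=
  (assign 0 (add (add (const 2) numLines) numLines)).seq <|
  (assign 1 (add (add (reg 0) numLines) numLines)).seq <|
  (assign 2 (add (add (reg 1) numLines) (const 1))).seq <|
  (assign 3 (const 0)).seq <| (assign 11 (const 0)).seq <|
  (loop (reg 11) (add numLines (const 1)) <|
    (store (add (reg 1) (reg 11)) (const 0)).seq (incr 11)).seq <|
  loop (load (add (reg 1) numLines)) (const 1) <| evaluate.seq <| save.seq increment

end RAM.Program

namespace MetroPath

open RAM RAM.Expr RAM.Program

/-- The sum of the first `j` values of `f`. -/
def partialSum {k : ℕ} (f : Fin k → ℕ) (j : ℕ) : ℕ :=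
  ∑ i with i.val < j, f i

theorem partialSum_zero {k : ℕ} (f : Fin k → ℕ) : partialSum f 0 = 0 := by
  simp [partialSum]

theorem partialSum_succ {k : ℕ} (f : Fin k → ℕ) {j : ℕ} (hj : j < k) :
    partialSum f (j + 1) = partialSum f j + f ⟨j, hj⟩ := by
  have h : (Finset.univ.filter fun i : Fin k => i.val < j + 1) =
      insert ⟨j, hj⟩ (Finset.univ.filter fun i : Fin k => i.val < j) := by
    ext i
    simp only [Finset.mem_filter, Finset.mem_univ, true_and, Finset.mem_insert, Fin.ext_iff]
    omega
  rw [partialSum, h, Finset.sum_insert (by simp), add_comm, partialSum]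

theorem partialSum_self {k : ℕ} (f : Fin k → ℕ) : partialSum f k = ∑ i, f i := by
  simp [partialSum]

theorem partialSum_le {k : ℕ} (f : Fin k → ℕ) (j c : ℕ) (h : ∀ i, f i ≤ c) :
    partialSum f j ≤ k * c := by
  refine (Finset.sum_le_sum_of_subset (Finset.filter_subset _ _)).trans ?_
  simpa using Finset.sum_le_card_nsmul Finset.univ f c fun i _ => h i

/-- The choice of left ends given by the binary digits of `m`. -/
def leftEnds (I : MetroPath) (m : ℕ) : Fin I.k → Bool := fun l => m.testBit l

/-- The machine state between two phases of the search: registers and memory are set up, and the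
counter is at `m`. -/
structure Searching (I : MetroPath) (m : ℕ) (s : State) : Prop where
  input : I.InputAt s.mem 0
  reg_zero : s.reg 0 = 2 + I.k + I.k
  reg_one : s.reg 1 = 2 + I.k + I.k + I.k + I.k
  reg_two : s.reg 2 = 2 + I.k + I.k + I.k + I.k + I.k + 1
  digit : ∀ l ≤ I.k, s.mem (2 + I.k + I.k + I.k + I.k + l) = (m.testBit l).toNat

variable {I : MetroPath} {W m : ℕ} {s : State} {Q : State → ℕ → Prop}

theorem InputAt.congr {f g : ℕ → ℕ} {b : ℕ} (h : I.InputAt f b)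
    (hfg : ∀ a, b ≤ a → a < b + (2 + I.k + I.k) → g a = f a) : I.InputAt g b := by
  refine ⟨?_, ?_, fun l => ⟨?_, ?_⟩⟩
  · rw [hfg _ (by omega) (by omega), h.1]
  · rw [hfg _ (by omega) (by omega), h.2.1]
  · rw [hfg _ (by omega) (by omega), (h.2.2 l).1]
  · rw [hfg _ (by omega) (by omega), (h.2.2 l).2]

theorem Searching.congr {s' : State} (h : I.Searching m s)
    (hm : ∀ a, a < 2 + I.k + I.k ∨ 2 + I.k + I.k + I.k + I.k ≤ a ∧
      a < 2 + I.k + I.k + I.k + I.k + I.k + 1 → s'.mem a = s.mem a)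
    (hr : ∀ r ≤ 2, s'.reg r = s.reg r) : I.Searching m s' where
  input := h.input.congr fun a _ h' => hm a (by omega)
  reg_zero := by rw [hr _ (by omega), h.reg_zero]
  reg_one := by rw [hr _ (by omega), h.reg_one]
  reg_two := by rw [hr _ (by omega), h.reg_two]
  digit l hl := by rw [hm _ (by omega), h.digit l hl]

theorem Searching.mem_zero (h : I.Searching m s) : s.mem 0 = I.n := h.input.1

theorem Searching.mem_one (h : I.Searching m s) : s.mem 1 = I.k := h.input.2.1

theorem Searching.left (h : I.Searching m s) (l : Fin I.k) :
    s.mem (2 + (l.val + l.val)) = I.left l := by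
  simpa using (h.input.2.2 l).1

theorem Searching.right (h : I.Searching m s) (l : Fin I.k) :
    s.mem (3 + (l.val + l.val)) = I.right l := by
  simpa using (h.input.2.2 l).2

theorem wp_computeKey (hW : 2 * I.n + I.k * I.k + 6 * I.k + 10 ≤ W) (h : I.Searching m s)
    (d r : ℕ) (l : Fin I.k) (hr : s.reg r = l)
    (hQ : ∀ t ≤ 20, Q (s.setReg d (I.startKey (I.leftEnds m) l)) t) :
    WP W (computeKey d r) Q s := by
  have h₁ := h.left l
  have h₂ := h.digit l l.2.le
  have := I.left_lt_right l
  have := I.right_le l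
  have := l.2
  have := h.mem_zero
  have := Bool.toNat_le (m.testBit l)
  simp only [computeKey, wp_branch, wp_assign, eval, Fits, cost, hr, h.reg_one, h₁, h₂, h.mem_zero]
  refine ⟨by omega, fun hb => ⟨by omega, ?_⟩, fun hb => ⟨by omega, ?_⟩⟩
  · convert hQ _ _ using 3
    · have : m.testBit l = false := by cases hb' : m.testBit l <;> simp_all
      simp [startKey, leftEnds, this]
    · omega
  · convert hQ _ _ using 3
    · have : m.testBit l = true := by cases hb' : m.testBit l <;> simp_all
      simp [startKey, leftEnds, this]
    · omega

theorem numBelow_le (I : MetroPath) (α : Fin I.k → Bool) (i : Fin I.k) : I.numBelow α i ≤ I.k :=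
  (Finset.card_le_univ _).trans (by simp)

theorem numAbove_le (I : MetroPath) (α : Fin I.k → Bool) (i : Fin I.k) : I.numAbove α i ≤ I.k :=
  (Finset.card_le_univ _).trans (by simp)

theorem wp_countSides (hW : 2 * I.n + I.k * I.k + 6 * I.k + 10 ≤ W) (h : I.Searching m s)
    (i : Fin I.k) (hi : s.reg 5 = i) :
    WP W countSides (fun s' t => s'.mem = s.mem ∧ (∀ r ≤ 5, s'.reg r = s.reg r) ∧
      s'.reg 7 = I.numBelow (I.leftEnds m) i ∧ s'.reg 8 = I.numAbove (I.leftEnds m) i ∧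
      t ≤ I.k * 90 + 50) s := by
  set α := I.leftEnds m with hα
  let fB : Fin I.k → ℕ := fun p => if (I.left p < I.right i ∧ I.right i < I.right p) ∧
    I.startKey α p < I.startKey α i then 1 else 0
  let fA : Fin I.k → ℕ := fun p => if (I.left p < I.right i ∧ I.right i < I.right p) ∧
    I.startKey α i < I.startKey α p then 1 else 0
  have hB : I.numBelow α i = partialSum fB I.k := by
    rw [partialSum_self, numBelow, Finset.card_filter]
  have hA : I.numAbove α i = partialSum fA I.k := by
    rw [partialSum_self, numAbove, Finset.card_filter]
  have hB' : ∀ j, partialSum fB j ≤ I.k := fun j =>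
    (partialSum_le fB j 1 fun p => by dsimp only [fB]; split_ifs <;> omega).trans (by omega)
  have hA' : ∀ j, partialSum fA j ≤ I.k := fun j =>
    (partialSum_le fA j 1 fun p => by dsimp only [fA]; split_ifs <;> omega).trans (by omega)
  have := i.2
  rw [countSides, wp_seq]
  refine wp_computeKey hW h 6 5 i hi fun t₀ ht₀ => ?_
  simp only [wp_seq, wp_assign, eval, Fits, cost]
  refine ⟨by omega, by omega, by omega, ?_⟩
  refine wp_loop I.k 80 (fun p s' => s'.mem = s.mem ∧ (∀ r ≤ 5, s'.reg r = s.reg r) ∧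
    s'.reg 6 = I.startKey α i ∧ s'.reg 7 = partialSum fB p ∧ s'.reg 8 = partialSum fA p ∧
    s'.reg 9 = p) ?_ ?_ ?_ ?_
  · rintro p s' hp ⟨hm, -, -, -, -, h9⟩
    simp only [Fits, eval, h9, hm, h.mem_one, and_true]
    omega
  · rintro p s' hp ⟨hm, hr, h6, h7, h8, h9⟩
    have hs' : I.Searching m s' := h.congr (fun a _ => by rw [hm]) fun r hr' => hr r (by omega)
    have h5 : s'.reg 5 = i := by rw [hr 5 le_rfl, hi]
    rw [wp_seq]
    refine wp_computeKey hW hs' 10 9 ⟨p, hp⟩ h9 fun t₁ ht₁ => ?_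
    rw [← hα]
    have hlp := hs'.left ⟨p, hp⟩
    have hrp := hs'.right ⟨p, hp⟩
    have hri := hs'.right i
    have := I.left_lt_right ⟨p, hp⟩
    have := I.right_le ⟨p, hp⟩
    have := I.right_le i
    have := I.startKey_lt α ⟨p, hp⟩
    have := I.startKey_lt α i
    have := hB' p
    have := hA' p
    have hB₁ : partialSum fB (p + 1) = partialSum fB p +
      if (I.left ⟨p, hp⟩ < I.right i ∧ I.right i < I.right ⟨p, hp⟩) ∧
        I.startKey α ⟨p, hp⟩ < I.startKey α i then 1 else 0 := partialSum_succ _ hp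
    have hA₁ : partialSum fA (p + 1) = partialSum fA p +
      if (I.left ⟨p, hp⟩ < I.right i ∧ I.right i < I.right ⟨p, hp⟩) ∧
        I.startKey α i < I.startKey α ⟨p, hp⟩ then 1 else 0 := partialSum_succ _ hp
    have hk : I.k ≤ W := by omega
    simp only at hlp hrp
    simp only [wp_seq, wp_branch, wp_assign, wp_skip, eval, Fits, cost, State.reg_setReg,
      State.mem_setReg, Nat.reduceEqDiff, if_true, if_false, h5, h6, h7, h8, h9, hlp, hrp, hri]
    refine ⟨by omega, fun c₁ => ⟨by omega, fun c₂ => ⟨by omega, fun c₃ => ?_, fun c₃ =>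
      ⟨by omega, fun c₄ => ?_, fun c₄ => ?_⟩⟩, fun c₂ => ?_⟩, fun c₁ => ?_⟩
    all_goals
      repeat' apply And.intro
      all_goals first
        | omega
        | exact hm
        | trivial
        | (rw [hB₁]; split_ifs <;> omega)
        | (rw [hA₁]; split_ifs <;> omega)
        | (intro r hr'; rw [← hr r hr']; split_ifs <;> omega)
  · simp only [State.reg_setReg, State.mem_setReg, Nat.reduceEqDiff, if_true, if_false,
      partialSum_zero, true_and, and_true]
    refine ⟨fun r hr' => ?_, rfl⟩
    split_ifs <;> omega
  · rintro s' t ⟨hm, hr, h6, h7, h8, h9⟩ ht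
    simp only [cost] at ht
    exact ⟨hm, hr, by rw [h7, hB], by rw [h8, hA], by omega⟩

/-- The number by which `minCrossings` stays below `k * k`. Maximizing it, rather than minimizing the
number of crossings, lets the search start with the value `0`, which any assignment attains. -/
def savings (I : MetroPath) (α : Fin I.k → Bool) : ℕ :=
  ∑ i, (I.k - min (I.numBelow α i) (I.numAbove α i))

theorem savings_add_minCrossings (I : MetroPath) (α : Fin I.k → Bool) :
    I.savings α + I.minCrossings α = I.k * I.k := by
  rw [savings, minCrossings, ← Finset.sum_add_distrib,
    Finset.sum_congr rfl fun i _ => Nat.sub_add_cancel ((min_le_left _ _).trans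
      (I.numBelow_le α i))]
  simp

theorem wp_evaluate (hW : 2 * I.n + I.k * I.k + 6 * I.k + 10 ≤ W) (h : I.Searching m s) :
    WP W evaluate (fun s' t => I.Searching m s' ∧ s'.reg 3 = s.reg 3 ∧
      s'.reg 4 = I.savings (I.leftEnds m) ∧
      (∀ j : Fin I.k, s'.mem (2 + I.k + I.k + I.k + I.k + I.k + 1 + j) =
        ((I.complete (I.leftEnds m)).right j).toNat) ∧
      (∀ a < 2 + I.k + I.k + I.k + I.k, s'.mem a = s.mem a) ∧
      t ≤ I.k * (I.k * 90 + 90) + 10) s := by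
  set α := I.leftEnds m with hα
  let f : Fin I.k → ℕ := fun i => I.k - min (I.numBelow α i) (I.numAbove α i)
  have hf : I.savings α = partialSum f I.k := by rw [partialSum_self, savings]
  have hf' : ∀ j, partialSum f j ≤ I.k * I.k := fun j =>
    partialSum_le f j I.k fun p => Nat.sub_le _ _
  simp only [evaluate, wp_seq, wp_assign, eval, Fits, cost]
  refine ⟨by omega, by omega, ?_⟩
  refine wp_loop I.k (I.k * 90 + 80) (fun i s' => I.Searching m s' ∧ s'.reg 3 = s.reg 3 ∧
    s'.reg 4 = partialSum f i ∧ s'.reg 5 = i ∧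
    (∀ j : Fin I.k, j.val < i → s'.mem (2 + I.k + I.k + I.k + I.k + I.k + 1 + j) =
      ((I.complete α).right j).toNat) ∧
    (∀ a < 2 + I.k + I.k + I.k + I.k, s'.mem a = s.mem a)) ?_ ?_ ?_ ?_
  · rintro i s' hi ⟨hs', -, -, h5, -⟩
    simp only [Fits, eval, h5, hs'.mem_one, and_true]
    omega
  · rintro i s' hi ⟨hs', h3, h4, h5, hj, hm⟩
    rw [wp_seq]
    refine (wp_countSides hW hs' ⟨i, hi⟩ h5).mono ?_
    rintro s₁ t₁ ⟨hm₁, hr₁, h7, h8, ht₁⟩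
    rw [← hα] at h7 h8
    have hs₁ : I.Searching m s₁ :=
      hs'.congr (fun a _ => by rw [hm₁]) fun r hr => hr₁ r (by omega)
    have := numBelow_le I α ⟨i, hi⟩
    have := numAbove_le I α ⟨i, hi⟩
    have hstep : partialSum f (i + 1) = partialSum f i + (I.k - min (I.numBelow α ⟨i, hi⟩)
      (I.numAbove α ⟨i, hi⟩)) := partialSum_succ f hi
    have := hf' (i + 1)
    have h5₁ : s₁.reg 5 = i := by rw [hr₁ 5 (by omega), h5]
    have h4₁ : s₁.reg 4 = partialSum f i := by rw [hr₁ 4 (by omega), h4]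
    have h3₁ : s₁.reg 3 = s.reg 3 := by rw [hr₁ 3 (by omega), h3]
    have hb : ((I.complete α).right ⟨i, hi⟩) =
      decide (I.numAbove α ⟨i, hi⟩ ≤ I.numBelow α ⟨i, hi⟩) := rfl
    have fin : ∀ (v c : ℕ), v = ((I.complete α).right ⟨i, hi⟩).toNat →
        c = partialSum f (i + 1) →
        I.Searching m (((s₁.setMem (2 + I.k + I.k + I.k + I.k + I.k + 1 + i) v).setReg 4 c).setReg
          5 (i + 1)) ∧ True ∧ c = partialSum f (i + 1) ∧ True ∧
        (∀ j : Fin I.k, j.val < i + 1 → (if 2 + I.k + I.k + I.k + I.k + I.k + 1 + j.val =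
          2 + I.k + I.k + I.k + I.k + I.k + 1 + i then v else
          s₁.mem (2 + I.k + I.k + I.k + I.k + I.k + 1 + j.val)) =
            ((I.complete α).right j).toNat) ∧
        (∀ a < 2 + I.k + I.k + I.k + I.k, (if a = 2 + I.k + I.k + I.k + I.k + I.k + 1 + i then v
          else s₁.mem a) = s.mem a) := by
      intro v c hv hc
      refine ⟨hs₁.congr (fun a ha => ?_) fun r hr => ?_, trivial, hc, trivial, fun j hj' => ?_,
        fun a ha => ?_⟩
      · simp only [State.mem_setReg, State.mem_setMem]
        rw [if_neg (by omega)]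
      · simp only [State.reg_setReg, State.reg_setMem]
        rw [if_neg (by omega), if_neg (by omega)]
      · split_ifs with hji
        · rw [hv, show j = ⟨i, hi⟩ from Fin.ext (show j.val = i by omega)]
        · rw [hm₁, hj j (by omega)]
      · rw [if_neg (by omega), hm₁, hm a ha]
    have hne : ¬ 1 = 2 + I.k + I.k + I.k + I.k + I.k + 1 + i := by omega
    simp only [wp_seq, wp_branch, wp_assign, wp_store, eval, Fits, cost, State.reg_setReg,
      State.mem_setReg, State.reg_setMem, State.mem_setMem, Nat.reduceEqDiff, if_true, if_false,
      h3₁, h4₁, h5₁, h7, h8, hs₁.mem_one, hs₁.reg_two, if_neg hne]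
    refine ⟨by omega, fun hlt => ⟨by omega, by omega, by omega, fin _ _ ?_ ?_, by omega⟩,
      fun hlt => ⟨by omega, by omega, by omega, fin _ _ ?_ ?_, by omega⟩⟩
    · rw [hb, decide_eq_false (by omega)]; rfl
    · omega
    · rw [hb, decide_eq_true (by omega)]; rfl
    · omega
  · simp only [State.reg_setReg, State.mem_setReg, Nat.reduceEqDiff, if_true, if_false,
      partialSum_zero, Nat.not_lt_zero, false_implies, implies_true, and_true]
    refine h.congr (fun _ _ => rfl) fun r hr => ?_
    simp only [State.reg_setReg]
    rw [if_neg (by omega), if_neg (by omega)]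
  · rintro s' t ⟨hs', h3, h4, h5, hj, hm⟩ ht
    simp only [cost] at ht
    have e : I.k * (1 + (1 + 1) + 1 + (I.k * 90 + 80)) + I.k * 6 = I.k * (I.k * 90 + 90) := by ring
    exact ⟨hs', h3, by rw [h4, hf], fun j => hj j j.2, hm, by omega⟩

theorem wp_save (hW : 2 * I.n + I.k * I.k + 6 * I.k + 10 ≤ W) (h : I.Searching m s)
    (h4 : s.reg 4 ≤ I.k * I.k)
    (hj : ∀ j : Fin I.k, s.mem (2 + I.k + I.k + I.k + I.k + I.k + 1 + j) =
      ((I.complete (I.leftEnds m)).right j).toNat) (h3 : s.reg 3 ≤ I.k * I.k) :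
    WP W save (fun s' t => I.Searching m s' ∧
      (s.reg 4 < s.reg 3 ∧ s'.reg 3 = s.reg 3 ∧ (∀ a, s'.mem a = s.mem a) ∨
        s.reg 3 ≤ s.reg 4 ∧ s'.reg 3 = s.reg 4 ∧
          AssignmentAt (I.complete (I.leftEnds m)) s'.mem (2 + I.k + I.k)) ∧
      t ≤ I.k * 50 + 20) s := by
  set α := I.leftEnds m with hα
  simp only [save, wp_seq, wp_branch, wp_assign, wp_skip, eval, Fits, cost]
  refine ⟨by omega, fun hlt => ⟨h, Or.inl ⟨hlt, trivial, fun _ => trivial⟩, by omega⟩, fun hge =>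
    ⟨by omega, by omega, ?_⟩⟩
  refine wp_loop I.k 40 (fun l s' => I.Searching m s' ∧ s'.reg 3 = s.reg 4 ∧ s'.reg 11 = l ∧
    (∀ j : Fin I.k, s'.mem (2 + I.k + I.k + I.k + I.k + I.k + 1 + j) =
      ((I.complete α).right j).toNat) ∧
    ∀ j : Fin I.k, j.val < l →
      s'.mem (2 + I.k + I.k + (j + j)) = ((I.complete α).left j).toNat ∧
      s'.mem (2 + I.k + I.k + (j + j + 1)) = ((I.complete α).right j).toNat) ?_ ?_ ?_ ?_
  · rintro l s' hl ⟨hs', -, h11, -, -⟩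
    simp only [Fits, eval, h11, hs'.mem_one, and_true]
    omega
  · rintro l s' hl ⟨hs', h3', h11, hr, hd⟩
    have hdig : s'.mem (2 + I.k + I.k + I.k + I.k + l) = ((I.complete α).left ⟨l, hl⟩).toNat :=
      hs'.digit l hl.le
    have hri := hr ⟨l, hl⟩
    simp only at hri
    have := Bool.toNat_le ((I.complete α).left ⟨l, hl⟩)
    have := Bool.toNat_le ((I.complete α).right ⟨l, hl⟩)
    simp only [wp_seq, wp_assign, wp_store, eval, Fits, cost, State.reg_setReg,
      State.mem_setReg, State.reg_setMem, State.mem_setMem, Nat.reduceEqDiff, if_true, if_false,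
      h11, hs'.reg_zero, hs'.reg_one, hs'.reg_two, hdig]
    rw [if_neg (by omega)]
    simp only [hri]
    refine ⟨by omega, by omega, by omega, ⟨hs'.congr (fun a ha => ?_) fun r hr => ?_, h3', trivial,
      fun j => ?_, fun j hj' => ?_⟩, by omega⟩
    · simp only [State.mem_setReg, State.mem_setMem]
      rw [if_neg (by omega), if_neg (by omega)]
    · simp only [State.reg_setReg, State.reg_setMem]
      rw [if_neg (by omega)]
    · rw [if_neg (by omega), if_neg (by omega), hr j]
    · by_cases hjl : j.val = l
      · have hjl' : j = ⟨l, hl⟩ := Fin.ext hjl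
        subst hjl'
        constructor
        · rw [if_neg (by simp only; omega), if_pos rfl]
        · rw [if_pos rfl]
      · have := hd j (by omega)
        constructor
        · rw [if_neg (by omega), if_neg (by omega), this.1]
        · rw [if_neg (by omega), if_neg (by omega), this.2]
  · simp only [State.reg_setReg, State.mem_setReg, Nat.reduceEqDiff, if_true, if_false,
      true_and, Nat.not_lt_zero, false_implies, implies_true, and_true]
    refine ⟨h.congr (fun _ _ => rfl) fun r hr => ?_, hj⟩
    simp only [State.reg_setReg]
    rw [if_neg (by omega), if_neg (by omega)]
  · rintro s' t ⟨hs', h3', -, -, hd⟩ ht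
    simp only [cost] at ht
    exact ⟨hs', Or.inr ⟨by omega, h3', fun j => hd j j.2⟩, by omega⟩

/-- The carry passes digit `l` if and only if it reaches this digit and the digit is `1`. -/
theorem pow_succ_dvd_succ_iff (m l : ℕ) :
    2 ^ (l + 1) ∣ m + 1 ↔ 2 ^ l ∣ m + 1 ∧ m.testBit l = true := by
  have hd := Nat.succ_div (a := m) (b := 2 ^ l)
  rw [Nat.testBit_eq_decide_div_mod_eq, decide_eq_true_eq]
  by_cases h : 2 ^ l ∣ m + 1
  · rw [if_pos h] at hd
    have : m + 1 = 2 ^ l * (m / 2 ^ l + 1) := by rw [← hd, Nat.mul_div_cancel' h]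
    simp only [h, true_and]
    rw [this, pow_succ, Nat.mul_dvd_mul_iff_left (by positivity)]
    omega
  · simp only [h, false_and, iff_false]
    exact fun h' => h ((pow_dvd_pow 2 (Nat.le_succ l)).trans h')

/-- Digit `l` changes if and only if the carry reaches it, that is, if `2 ^ l` divides `m + 1`. -/
theorem testBit_succ_toNat (m l : ℕ) : ((m + 1).testBit l).toNat =
    if 2 ^ l ∣ m + 1 then 1 - (m.testBit l).toNat else (m.testBit l).toNat := by
  have hd := Nat.succ_div (a := m) (b := 2 ^ l)
  rw [Nat.testBit_eq_decide_div_mod_eq, Nat.testBit_eq_decide_div_mod_eq, hd]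
  split_ifs
  · by_cases h : m / 2 ^ l % 2 = 1
    · rw [decide_eq_true h, decide_eq_false (by omega)]; rfl
    · rw [decide_eq_false h, decide_eq_true (by omega)]; rfl
  · rfl

theorem wp_increment (hW : 2 * I.n + I.k * I.k + 6 * I.k + 10 ≤ W) (h : I.Searching m s) :
    WP W increment (fun s' t => I.Searching (m + 1) s' ∧ s'.reg 3 = s.reg 3 ∧
      (∀ a < 2 + I.k + I.k + I.k + I.k, s'.mem a = s.mem a) ∧ t ≤ I.k * 50 + 70) s := by
  simp only [increment, wp_seq, wp_assign, eval, Fits, cost]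
  refine ⟨by omega, by omega, ?_⟩
  -- The carry reaches digit `l` if and only if all lower digits are `1`.
  refine wp_loop (I.k + 1) 40 (fun l s' => (∀ r ≤ 3, s'.reg r = s.reg r) ∧ s'.reg 11 = l ∧
    s'.reg 12 = (if 2 ^ l ∣ m + 1 then 1 else 0) ∧
    (∀ a < 2 + I.k + I.k + I.k + I.k, s'.mem a = s.mem a) ∧
    (∀ j < l, s'.mem (2 + I.k + I.k + I.k + I.k + j) = ((m + 1).testBit j).toNat) ∧
    (∀ j, l ≤ j → j ≤ I.k → s'.mem (2 + I.k + I.k + I.k + I.k + j) = (m.testBit j).toNat))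
    ?_ ?_ ?_ ?_
  · rintro l s' hl ⟨-, h11, -, hm, -⟩
    have h₁ : s'.mem 1 = I.k := by rw [hm 1 (by omega), h.mem_one]
    simp only [Fits, eval, h11, h₁, and_true]
    omega
  · rintro l s' hl ⟨hr, h11, h12, hm, hlow, hhigh⟩
    have h₁ : s'.reg 1 = 2 + I.k + I.k + I.k + I.k := by rw [hr 1 (by omega), h.reg_one]
    have hd := hhigh l le_rfl (by omega)
    have hb := Bool.toNat_le (m.testBit l)
    have hs := testBit_succ_toNat m l
    have hc := pow_succ_dvd_succ_iff m l
    have hbit : m.testBit l = true ↔ (m.testBit l).toNat = 1 := by cases m.testBit l <;> simp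
    rw [hbit] at hc
    have fin : ∀ v, v = ((m + 1).testBit l).toNat →
        (∀ a < 2 + I.k + I.k + I.k + I.k, (if a = 2 + I.k + I.k + I.k + I.k + l then v
          else s'.mem a) = s.mem a) ∧
        (∀ j < l + 1, (if 2 + I.k + I.k + I.k + I.k + j = 2 + I.k + I.k + I.k + I.k + l then v
          else s'.mem (2 + I.k + I.k + I.k + I.k + j)) = ((m + 1).testBit j).toNat) ∧
        (∀ j, l + 1 ≤ j → j ≤ I.k →
          (if 2 + I.k + I.k + I.k + I.k + j = 2 + I.k + I.k + I.k + I.k + l then v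
          else s'.mem (2 + I.k + I.k + I.k + I.k + j)) = (m.testBit j).toNat) := by
      refine fun v hv => ⟨fun a ha => ?_, fun j hj => ?_, fun j hj hj' => ?_⟩
      · rw [if_neg (by omega), hm a ha]
      · split_ifs with he
        · rw [hv, show j = l by omega]
        · exact hlow j (by omega)
      · rw [if_neg (by omega), hhigh j (by omega) hj']
    simp only [wp_seq, wp_branch, wp_assign, wp_store, eval, Fits, cost, State.reg_setReg,
      State.mem_setReg, State.reg_setMem, State.mem_setMem, Nat.reduceEqDiff, if_true, if_false,
      h11, h12, h₁, hd, hc]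
    by_cases hdvd : 2 ^ l ∣ m + 1
    · simp only [hdvd, if_true, true_and] at hs ⊢
      refine ⟨by omega, fun hlt => ⟨by omega, by omega, by omega, ⟨fun r hr' => ?_, ?_,
        fin _ (by omega)⟩, by omega⟩, fun hge => ⟨by omega, by omega, ⟨fun r hr' => ?_, ?_,
        fin _ (by omega)⟩, by omega⟩⟩
      · rw [if_neg (by omega), if_neg (by omega), hr r hr']
      · rw [if_neg (by omega)]
      · rw [if_neg (by omega), hr r hr']
      · rw [if_pos (by omega)]
    · simp only [hdvd, if_false, false_and] at hs ⊢
      refine ⟨by omega, fun hlt => absurd hlt (by omega), fun hge => ⟨by omega, by omega,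
        ⟨fun r hr' => ?_, trivial, trivial, fin _ (by omega)⟩, by omega⟩⟩
      rw [if_neg (by omega), hr r hr']
  · simp only [State.reg_setReg, State.mem_setReg, Nat.reduceEqDiff, if_true, if_false,
      pow_zero, one_dvd, Nat.not_lt_zero, false_implies, implies_true, true_and]
    refine ⟨fun r hr => ?_, fun j _ hj => h.digit j hj⟩
    rw [if_neg (by omega), if_neg (by omega)]
  · rintro s' t ⟨hr, -, -, hm, hd, -⟩ ht
    simp only [cost] at ht
    refine ⟨⟨h.input.congr fun a _ ha => hm a (by omega), ?_, ?_, ?_, fun l hl => hd l (by omega)⟩,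
      hr 3 le_rfl, hm, by omega⟩
    · rw [hr 0 (by omega), h.reg_zero]
    · rw [hr 1 (by omega), h.reg_one]
    · rw [hr 2 (by omega), h.reg_two]

/-- The last of the numbers below `m` whose digits are left ends with maximum savings. -/
def bestIndex (I : MetroPath) : ℕ → ℕ
  | 0 => 0
  | m + 1 => if I.savings (I.leftEnds m) < I.savings (I.leftEnds (bestIndex I m)) then
      bestIndex I m else m

theorem savings_le_bestIndex (I : MetroPath) {m m' : ℕ} (h : m' < m) :
    I.savings (I.leftEnds m') ≤ I.savings (I.leftEnds (I.bestIndex m)) := by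
  induction m with
  | zero => omega
  | succ m ih =>
    rw [bestIndex]
    rcases Nat.lt_succ_iff_lt_or_eq.1 h with h' | rfl
    · have := ih h'
      split_ifs <;> omega
    · split_ifs <;> omega

/-- The assignment computed by the search. -/
def bestAssignment (I : MetroPath) : Assignment I :=
  I.complete (I.leftEnds (I.bestIndex (2 ^ I.k)))

theorem exists_leftEnds_eq (I : MetroPath) (α : Fin I.k → Bool) :
    ∃ m < 2 ^ I.k, I.leftEnds m = α :=
  ⟨Nat.ofBits α, Nat.ofBits_lt_two_pow α, funext fun l => Nat.testBit_ofBits_lt α l l.2⟩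

theorem minCrossings_bestAssignment_le (I : MetroPath) (α : Fin I.k → Bool) :
    I.minCrossings I.bestAssignment.left ≤ I.minCrossings α := by
  obtain ⟨m, hm, rfl⟩ := I.exists_leftEnds_eq α
  have h := I.savings_le_bestIndex hm
  have h₁ := I.savings_add_minCrossings (I.leftEnds m)
  have h₂ := I.savings_add_minCrossings (I.leftEnds (I.bestIndex (2 ^ I.k)))
  have h₃ : I.bestAssignment.left = I.leftEnds (I.bestIndex (2 ^ I.k)) := rfl
  rw [h₃]
  omega

theorem savings_le (I : MetroPath) (α : Fin I.k → Bool) : I.savings α ≤ I.k * I.k := by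
  have := I.savings_add_minCrossings α
  omega

/-- The time that `findAssignment` takes for one choice of left ends. -/
def roundTime (k : ℕ) : ℕ := k * (k * 90 + 90) + k * 100 + 100

theorem wp_round (hW : 2 * I.n + I.k * I.k + 6 * I.k + 10 ≤ W) (h : I.Searching m s)
    (hbest : m = 0 ∧ s.reg 3 = 0 ∨ 0 < m ∧ s.reg 3 = I.savings (I.leftEnds (I.bestIndex m)) ∧
      AssignmentAt (I.complete (I.leftEnds (I.bestIndex m))) s.mem (2 + I.k + I.k)) :
    WP W (evaluate.seq <| save.seq increment) (fun s' t => (I.Searching (m + 1) s' ∧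
      s'.reg 3 = I.savings (I.leftEnds (I.bestIndex (m + 1))) ∧
      AssignmentAt (I.complete (I.leftEnds (I.bestIndex (m + 1)))) s'.mem (2 + I.k + I.k)) ∧
      t ≤ roundTime I.k) s := by
  rw [wp_seq]
  refine (wp_evaluate hW h).mono ?_
  rintro s₁ t₁ ⟨hs₁, h3₁, h4₁, hj₁, hm₁, ht₁⟩
  rw [wp_seq]
  have hle := I.savings_le (I.leftEnds m)
  have hle' := I.savings_le (I.leftEnds (I.bestIndex m))
  refine (wp_save hW hs₁ (by omega) hj₁ (by omega)).mono ?_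
  rintro s₂ t₂ ⟨hs₂, hsave, ht₂⟩
  refine (wp_increment hW hs₂).mono ?_
  rintro s₃ t₃ ⟨hs₃, h3₃, hm₃, ht₃⟩
  have hcopy : ∀ a : Assignment I, AssignmentAt a s₂.mem (2 + I.k + I.k) →
      AssignmentAt a s₃.mem (2 + I.k + I.k) := fun a ha l => by
    rw [hm₃ _ (by omega), hm₃ _ (by omega)]; exact ha l
  refine ⟨⟨hs₃, ?_⟩, by unfold roundTime; omega⟩
  rcases hsave with ⟨hlt, h3₂, hm₂⟩ | ⟨hge, h3₂, ha₂⟩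
  · rcases hbest with ⟨rfl, h0⟩ | ⟨hm0, hv, ha⟩
    · omega
    · rw [bestIndex, if_pos (by omega)]
      refine ⟨by omega, hcopy _ fun l => ?_⟩
      rw [hm₂, hm₂, hm₁ _ (by omega), hm₁ _ (by omega)]
      exact ha l
  · have hb : I.bestIndex (m + 1) = m := by
      rw [bestIndex]
      rcases hbest with ⟨rfl, h0⟩ | ⟨hm0, hv, ha⟩
      · rw [bestIndex]; split_ifs <;> rfl
      · rw [if_neg (by omega)]
    rw [hb]
    exact ⟨by omega, hcopy _ ha₂⟩

theorem computes_findAssignment (hW : 2 * I.n + I.k * I.k + 6 * I.k + 10 ≤ W) :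
    Computes W (2 ^ I.k * (roundTime I.k + 10) + I.k * 50 + 100) findAssignment I.encode
      (I.encode ++ I.bestAssignment.encode) := by
  intro s hs
  rw [holds_encode_iff] at hs
  have h₁ : s.mem 1 = I.k := hs.2.1
  suffices h : WP W findAssignment (fun s' t => t ≤ 2 ^ I.k * (roundTime I.k + 10) + I.k * 50 + 100 ∧
      Holds s' (I.encode ++ I.bestAssignment.encode)) s from h
  simp only [findAssignment, wp_seq, wp_assign, eval, Fits, cost, State.reg_setReg,
    State.mem_setReg, if_true, h₁]
  refine ⟨by omega, by omega, by omega, by omega, by omega, ?_⟩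
  refine wp_loop (I.k + 1) 30 (fun l s' => s'.reg 0 = 2 + I.k + I.k ∧
    s'.reg 1 = 2 + I.k + I.k + I.k + I.k ∧ s'.reg 2 = 2 + I.k + I.k + I.k + I.k + I.k + 1 ∧
    s'.reg 3 = 0 ∧ s'.reg 11 = l ∧ I.InputAt s'.mem 0 ∧
    ∀ j < l, s'.mem (2 + I.k + I.k + I.k + I.k + j) = 0) ?_ ?_ ?_ ?_
  · rintro l s' hl ⟨-, -, -, -, h11, hin, -⟩
    simp only [Fits, eval, h11, hin.2.1, and_true]
    omega
  · rintro l s' hl ⟨h0, h1, h2, h3, h11, hin, hz⟩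
    simp only [wp_seq, wp_assign, wp_store, eval, Fits, cost, State.reg_setReg,
      State.mem_setReg, State.reg_setMem, State.mem_setMem, Nat.reduceEqDiff, if_true, if_false,
      h0, h1, h2, h3, h11, true_and]
    refine ⟨by omega, by omega, ⟨hin.congr fun a _ ha => ?_, fun j hj => ?_⟩, by omega⟩
    · rw [State.mem_setMem, if_neg (by omega)]
    · split_ifs with he
      · rfl
      · exact hz j (by omega)
  · simp only [State.reg_setReg, State.mem_setReg, Nat.reduceEqDiff, if_true, if_false,
      Nat.not_lt_zero, false_implies, implies_true, and_true, hs]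
  · rintro s₁ t₁ ⟨h0, h1, h2, h3, -, hin, hz⟩ ht₁
    have hs₁ : I.Searching 0 s₁ := ⟨hin, h0, h1, h2, fun l hl => by
      rw [hz l (by omega), Nat.zero_testBit]; rfl⟩
    refine wp_loop (2 ^ I.k) (roundTime I.k) (fun m s' => I.Searching m s' ∧
      (m = 0 ∧ s'.reg 3 = 0 ∨ 0 < m ∧ s'.reg 3 = I.savings (I.leftEnds (I.bestIndex m)) ∧
        AssignmentAt (I.complete (I.leftEnds (I.bestIndex m))) s'.mem (2 + I.k + I.k)))
      ?_ ?_ ⟨hs₁, Or.inl ⟨rfl, h3⟩⟩ ?_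
    · rintro m s' hm ⟨hs', -⟩
      have hd := hs'.digit I.k le_rfl
      have hbit : m.testBit I.k = true ↔ m = 2 ^ I.k := by
        constructor
        · exact fun h => le_antisymm hm (Nat.ge_two_pow_of_testBit h)
        · rintro rfl; exact Nat.testBit_two_pow_self
      have := Bool.toNat_le (m.testBit I.k)
      simp only [Fits, eval, hs'.reg_one, hs'.mem_one, hd]
      refine ⟨by omega, ?_⟩
      by_cases hm' : m = 2 ^ I.k
      · rw [hbit.2 hm']; simp [hm']
      · have : m.testBit I.k = false := by simpa using fun h => hm' (hbit.1 h)
        rw [this]; simp; omega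
    · rintro m s' hm ⟨hs', hb⟩
      exact (wp_round hW hs' hb).mono fun s'' t ⟨⟨c₁, c₂, c₃⟩, ht⟩ =>
        ⟨⟨c₁, Or.inr ⟨by omega, c₂, c₃⟩⟩, ht⟩
    · rintro s₂ t₂ ⟨hs₂, hb⟩ ht₂
      have hpos : 0 < 2 ^ I.k := by positivity
      have ha := (hb.resolve_left (by omega)).2.2
      simp only [cost] at ht₁ ht₂
      refine ⟨?_, (holds_append_iff _ _).2 ⟨hs₂.input, ha⟩⟩
      rw [show 1 + (1 + 1) + 1 + 1 + 1 + 1 + roundTime I.k = roundTime I.k + 7 by omega] at ht₂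
      have : 2 ^ I.k * (roundTime I.k + 7) ≤ 2 ^ I.k * (roundTime I.k + 10) :=
        Nat.mul_le_mul_left _ (by omega)
      omega

theorem keyLayout_bestAssignment_solvesP (I : MetroPath) :
    (I.keyLayout I.bestAssignment).SolvesP := by
  refine ⟨I.keyLayout_admissible _, (I.keyLayout_respects _).periphery, fun Λ hΛ hp => ?_⟩
  obtain ⟨a, ha⟩ := hp.exists_respects
  exact (I.crossings_keyLayout_complete_le _).trans
    ((I.minCrossings_bestAssignment_le a.left).trans (minCrossings_le hΛ ha))

end MetroPath

/-! ### Programs that write lists -/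

namespace RAM

/-- The cells from address `b` on hold `xs`, and register `9` points behind them. -/
def Emitted (s : State) (b : ℕ) (xs : List ℕ) : Prop :=
  s.reg 9 = b + xs.length ∧ ∀ i v, xs[i]? = some v → s.mem (b + i) = v

/-- In every state with `Env`, the program appends `xs` to the list that starts at address `b`, as
long as that list keeps to `lim` cells; it takes at most `T` steps and leaves `Env` true. -/
def Emits (W : ℕ) (Env : State → Prop) (b lim T : ℕ) (c : Program) (xs : List ℕ) : Prop :=
  ∀ s pre, Env s → Emitted s b pre → pre.length + xs.length ≤ lim →
    WP W c (fun s' t => (Env s' ∧ Emitted s' b (pre ++ xs)) ∧ t ≤ T) s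

variable {W b lim T T₁ T₂ : ℕ} {Env Env' : State → Prop} {c d : Program} {xs ys : List ℕ}

theorem Emitted.setReg {s : State} (h : Emitted s b xs) {r : ℕ} (hr : r ≠ 9) (v : ℕ) :
    Emitted (s.setReg r v) b xs := by
  refine ⟨?_, h.2⟩
  rw [State.reg_setReg, if_neg hr.symm, h.1]

theorem Emits.mono (h : Emits W Env b lim T c xs) (hT : T ≤ T₁) : Emits W Env b lim T₁ c xs :=
  fun s pre h₁ h₂ h₃ => (h s pre h₁ h₂ h₃).mono fun _ _ hq => ⟨hq.1, hq.2.trans hT⟩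

theorem emits_seq (hc : Emits W Env b lim T₁ c xs) (hd : Emits W Env b lim T₂ d ys) :
    Emits W Env b lim (T₁ + T₂) (c.seq d) (xs ++ ys) := by
  intro s pre h₁ h₂ h₃
  rw [List.length_append] at h₃
  rw [wp_seq]
  refine (hc s pre h₁ h₂ (by omega)).mono ?_
  rintro s₁ t₁ ⟨⟨e₁, m₁⟩, ht₁⟩
  refine (hd s₁ _ e₁ m₁ (by rw [List.length_append]; omega)).mono ?_
  rintro s₂ t₂ ⟨⟨e₂, m₂⟩, ht₂⟩
  exact ⟨⟨e₂, by rwa [List.append_assoc] at m₂⟩, by omega⟩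

theorem emits_branch (P : Prop) [Decidable P] {x y : Expr}
    (h : ∀ s, Env s → (x.Fits W s ∧ y.Fits W s) ∧ (x.eval s < y.eval s ↔ P))
    (hc : Emits W Env b lim T c xs) (hT : 1 ≤ T) :
    Emits W Env b lim (x.cost + y.cost + 1 + T) (.branch x y c .skip) (if P then xs else []) := by
  intro s pre h₁ h₂ h₃
  obtain ⟨hf, hP⟩ := h s h₁
  rw [wp_branch]
  refine ⟨hf, fun hlt => ?_, fun hge => ?_⟩
  · rw [if_pos (hP.1 hlt)] at h₃ ⊢
    exact (hc s pre h₁ h₂ h₃).mono fun s' t hq => ⟨hq.1, by omega⟩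
  · rw [if_neg fun hp => hge (hP.2 hp), List.append_nil, wp_skip]
    exact ⟨⟨h₁, h₂⟩, by omega⟩

/-- A command that computes auxiliary values before the program goes on writing. -/
theorem emits_prepare
    (hc : ∀ s, Env s → WP W c (fun s' t => (Env' s' ∧ s'.reg 9 = s.reg 9 ∧ s'.mem = s.mem) ∧
      t ≤ T₁) s)
    (hd : Emits W Env' b lim T₂ d xs) (hE : ∀ s, Env' s → Env s) :
    Emits W Env b lim (T₁ + T₂) (c.seq d) xs := by
  intro s pre h₁ h₂ h₃
  rw [wp_seq]
  refine (hc s h₁).mono ?_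
  rintro s₁ t₁ ⟨⟨e₁, r₁, m₁⟩, ht₁⟩
  refine (hd s₁ pre e₁ ⟨by rw [r₁, h₂.1], by rw [m₁]; exact h₂.2⟩ h₃).mono ?_
  rintro s₂ t₂ ⟨⟨e₂, m₂⟩, ht₂⟩
  exact ⟨⟨hE _ e₂, m₂⟩, by omega⟩

namespace Program

/-- Writes the value of register `r`. -/
def emit (r : ℕ) : Program := (store (.reg 9) (.reg r)).seq (incr 9)

/-- Runs `c` with the values from `a` up to, but not including, `y` in register `r`. -/
def forLoop (r a : ℕ) (y : Expr) (c : Program) : Program :=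
  (assign r (.const a)).seq <| loop (.reg r) y <| c.seq (incr r)

end Program

open Program

theorem emits_emit {r v : ℕ} (hlim : b + lim + 1 ≤ W) (hv : v ≤ W) (hr : ∀ s, Env s → s.reg r = v)
    (hmem : ∀ s i u, i < lim → Env s → Env (s.setMem (b + i) u))
    (hreg : ∀ s u, Env s → Env (s.setReg 9 u)) : Emits W Env b lim 7 (emit r) [v] := by
  intro s pre h₁ h₂ h₃
  rw [List.length_singleton] at h₃
  have h9 := h₂.1
  simp only [emit, wp_seq, wp_store, wp_assign, Expr.eval, Expr.Fits, Expr.cost, hr s h₁,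
    State.reg_setMem, h9]
  refine ⟨by omega, by omega, ⟨hreg _ _ (hmem _ _ _ (by omega) h₁), ?_, ?_⟩, by omega⟩
  · rw [State.reg_setReg, if_pos rfl, List.length_append, List.length_singleton]; omega
  · intro i u hi
    rw [State.mem_setReg, State.mem_setMem]
    by_cases hil : i = pre.length
    · subst hil
      simpa using hi
    · rw [if_neg (by omega)]
      obtain ⟨hi', -⟩ := List.getElem?_eq_some_iff.1 hi
      rw [List.length_append, List.length_singleton] at hi'
      rw [List.getElem?_append_left (by omega)] at hi
      exact h₂.2 i u hi

theorem emits_forLoop {r a M : ℕ} {y : Expr} {f : ℕ → List ℕ} (hr : r ≠ 9)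
    (haW : a + M + 1 ≤ W) (hreg : ∀ s u, Env s → Env (s.setReg r u))
    (hy : ∀ s m, Env s → m ≤ M → y.Fits W s ∧ (a + m < y.eval s ↔ m < M))
    (hc : ∀ m < M, Emits W (fun s => Env s ∧ s.reg r = a + m) b lim T c (f (a + m))) :
    Emits W Env b lim (M * (y.cost + T + 6) + y.cost + 4) (forLoop r a y c)
      ((List.range' a M).flatMap f) := by
  intro s pre h₁ h₂ h₃
  simp only [forLoop, wp_seq, wp_assign, Expr.eval, Expr.Fits, Expr.cost]
  refine ⟨by omega, ?_⟩
  refine wp_loop M (T + 4) (fun m s' => Env s' ∧ s'.reg r = a + m ∧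
    Emitted s' b (pre ++ (List.range' a m).flatMap f)) ?_ ?_ ?_ ?_
  · rintro m s' hm ⟨he, hreg', -⟩
    have := hy s' m he hm
    simp only [Expr.Fits, Expr.eval, hreg']
    exact ⟨⟨by omega, this.1⟩, this.2⟩
  · rintro m s' hm ⟨he, hreg', hem⟩
    have hsplit : (List.range' a (m + 1)).flatMap f =
        (List.range' a m).flatMap f ++ f (a + m) := by
      rw [List.range'_1_concat, List.flatMap_append, List.flatMap_singleton]
    have hlen : ((List.range' a (m + 1)).flatMap f).length ≤
        ((List.range' a M).flatMap f).length := by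
      have : List.range' a M = List.range' a (m + 1) ++ List.range' (a + (m + 1)) (M - (m + 1)) := by
        rw [List.range'_append_1]; congr 1; omega
      rw [this, List.flatMap_append, List.length_append]
      omega
    rw [hsplit, List.length_append] at hlen
    rw [wp_seq]
    refine (hc m hm s' _ ⟨he, hreg'⟩ hem (by rw [List.length_append]; omega)).mono ?_
    rintro s₁ t₁ ⟨⟨⟨e₁, r₁⟩, m₁⟩, ht₁⟩
    simp only [wp_assign, Expr.eval, Expr.Fits, Expr.cost, r₁, State.reg_setReg, if_true]
    refine ⟨by omega, ⟨hreg _ _ e₁, by omega, ?_⟩, by omega⟩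
    rw [hsplit, ← List.append_assoc]
    exact m₁.setReg hr _
  · refine ⟨hreg _ _ h₁, by rw [State.reg_setReg, if_pos rfl, Nat.add_zero], ?_⟩
    simpa using h₂.setReg hr a
  · rintro s' t ⟨he, -, hem⟩ ht
    refine ⟨⟨he, hem⟩, ?_⟩
    simp only [Expr.cost] at ht
    have : M * (1 + y.cost + 1 + (T + 4)) = M * (y.cost + T + 6) := by ring
    omega

/-- A loop over the indices of a list `L`. -/
theorem emits_forLoop_list {α : Type*} (L : List α) {r : ℕ} {y : Expr} {f : α → List ℕ}
    (hr : r ≠ 9) (haW : L.length + 1 ≤ W) (hreg : ∀ s u, Env s → Env (s.setReg r u))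
    (hy : ∀ s, Env s → y.Fits W s ∧ y.eval s = L.length)
    (hc : ∀ (m : ℕ) (hm : m < L.length),
      Emits W (fun s => Env s ∧ s.reg r = m) b lim T c (f L[m])) :
    Emits W Env b lim (L.length * (y.cost + T + 6) + y.cost + 4) (forLoop r 0 y c)
      (L.flatMap f) := by
  have h := emits_forLoop (W := W) (Env := Env) (b := b) (lim := lim) (T := T) (c := c) (r := r)
    (a := 0) (M := L.length) (y := y) (f := fun m => (L[m]?.map f).getD []) hr (by omega) hreg
    (fun s m hs hm => by rw [(hy s hs).2, Nat.zero_add]; exact ⟨(hy s hs).1, Iff.rfl⟩)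
    (fun m hm => by simpa [hm] using hc m hm)
  convert h using 1
  have : L.map f = (List.range' 0 L.length).map fun m => (L[m]?.map f).getD [] := by
    refine List.ext_getElem? fun i => ?_
    by_cases hi : i < L.length <;> simp [hi]
  rw [List.flatMap_def, List.flatMap_def, this]

end RAM

/-! ### The program for optimal layouts -/

namespace RAM.Program

open RAM.Expr

/-- A number that is zero if and only if `x` and `y` have the same value. -/
abbrev dist (x y : Expr) : Expr := add (sub x y) (sub y x)

/-- The left end of the line whose number is in register `r`, with the input at the address in
register `2`. -/
abbrev leftEndCopy (r : ℕ) : Expr := load (add (reg 2) (add (const 2) (add (reg r) (reg r))))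

/-- The right end of the line whose number is in register `r`, with the input at the address in
register `2`. -/
abbrev rightEndCopy (r : ℕ) : Expr := load (add (reg 2) (add (const 3) (add (reg r) (reg r))))

/-- The side of the left end of the line whose number is in register `r`. -/
abbrev leftSide (r : ℕ) : Expr := load (add (reg 3) (add (reg r) (reg r)))

/-- The side of the right end of the line whose number is in register `r`. -/
abbrev rightSide (r : ℕ) : Expr := load (add (reg 3) (add (add (reg r) (reg r)) (const 1)))

/-- Writes the two keys of line number `reg 7` into registers `10` and `11`. -/
def computeKeys : Program :=
  (branch (leftSide 7) (const 1) (assign 10 (sub (reg 0) (leftEndCopy 7)))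
    (assign 10 (add (reg 0) (leftEndCopy 7)))).seq <|
  branch (rightSide 7) (const 1) (assign 11 (rightEndCopy 7))
    (assign 11 (sub (add (add (reg 0) (reg 0)) (const 1)) (rightEndCopy 7)))

/-- Writes the list of all lines sorted by their keys to the address in register `4`. -/
def sortLines : Program :=
  (assign 9 (reg 4)).seq <|
  forLoop 5 0 (add (add (reg 0) (reg 0)) (const 1)) <|
  forLoop 6 0 (add (add (reg 0) (reg 0)) (const 1)) <|
  forLoop 7 0 (reg 1) <|
  computeKeys.seq <|
  branch (add (dist (reg 5) (reg 10)) (dist (reg 6) (reg 11))) (const 1) (emit 7) skip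

/-- Loads entry number `reg 7` of the sorted list into register `8`, and writes the group of that
line on edge `reg 5` into register `10`. -/
def computeGroup : Program :=
  (assign 8 (load (add (reg 4) (reg 7)))).seq <|
  branch (reg 5) (leftEndCopy 8) (assign 10 (const 3)) <|
  branch (reg 5) (rightEndCopy 8)
    (branch (add (reg 5) (const 1)) (rightEndCopy 8) (assign 10 (const 1))
      (assign 10 (add (rightSide 8) (rightSide 8))))
    (assign 10 (const 3))

/-- Writes the layout, edge by edge, from address `0` on. -/
def writeLayout : Program :=
  (assign 9 (const 0)).seq <|
  forLoop 5 1 (reg 0) <|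
  (forLoop 7 0 (reg 1) <| computeGroup.seq <| branch (reg 10) (const 3) (emit 8) skip).seq <|
  forLoop 6 0 (const 3) <| forLoop 7 0 (reg 1) <| computeGroup.seq <|
  branch (dist (reg 6) (reg 10)) (const 1) (emit 8) skip

/-- Copies the input behind the space that the output needs, which is at most `2 * n * k` cells. Its
address goes into register `2`, that of the copied assignment into register `3`, and that of the
free space after them into register `4`. -/
def copyInput : Program :=
  (assign 0 (load (const 0))).seq <| (assign 1 (load (const 1))).seq <|
  (assign 2 (add (add (const 2) (add (reg 1) (reg 1))) (add (reg 1) (reg 1)))).seq <|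
  (assign 5 (const 0)).seq <|
  (loop (reg 5) (reg 0) <| (assign 2 (add (reg 2) (add (reg 1) (reg 1)))).seq (incr 5)).seq <|
  (assign 5 (const 0)).seq <|
  (loop (reg 5) (add (add (const 2) (add (reg 1) (reg 1))) (add (reg 1) (reg 1))) <|
    (store (add (reg 2) (reg 5)) (load (reg 5))).seq (incr 5)).seq <|
  (assign 3 (add (reg 2) (add (const 2) (add (reg 1) (reg 1))))).seq <|
  assign 4 (add (reg 3) (add (reg 1) (reg 1)))

/-- Computes an optimal layout for a given assignment. -/
def findLayout : Program := copyInput.seq <| sortLines.seq writeLayout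

end RAM.Program

theorem List.map_filter_eq_flatMap {α β : Type*} (L : List α) (p : α → Prop) [DecidablePred p]
    (f : α → β) : (L.filter p).map f = L.flatMap fun x => if p x then [f x] else [] := by
  induction L with
  | nil => rfl
  | cons x L ih =>
    by_cases h : p x <;> simp [h, ih]

theorem List.length_flatMap_le {α β : Type*} (L : List α) (f : α → List β) (c : ℕ)
    (h : ∀ x ∈ L, (f x).length ≤ c) : (L.flatMap f).length ≤ L.length * c := by
  rw [List.length_flatMap]
  simpa using List.sum_le_card_nsmul (L.map fun x => (f x).length) c (by simpa using h)

theorem mul_add_add_le {A B b c d : ℕ} (M : ℕ) (h : A ≤ B) (h' : b + c ≤ d) :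
    M * A + b + c ≤ M * B + d := by
  rw [add_assoc]
  exact Nat.add_le_add (Nat.mul_le_mul_left M h) h'

namespace MetroPath

open RAM RAM.Expr RAM.Program

/-- The address to which the input is copied. -/
def copyBase (I : MetroPath) : ℕ := 2 + (I.k + I.k) + (I.k + I.k) + I.n * (I.k + I.k)

/-- A bound on the numbers that `findLayout` uses. -/
def layoutBound (I : MetroPath) : ℕ := I.copyBase + 8 * I.k + 8 * I.n + 20

/-- The machine state after the input has been copied. -/
structure Copied (I : MetroPath) (a : Assignment I) (s : State) : Prop where
  reg_zero : s.reg 0 = I.n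
  reg_one : s.reg 1 = I.k
  reg_two : s.reg 2 = I.copyBase
  reg_three : s.reg 3 = I.copyBase + (2 + (I.k + I.k))
  reg_four : s.reg 4 = I.copyBase + (2 + (I.k + I.k)) + (I.k + I.k)
  input : I.InputAt s.mem I.copyBase
  assignment : AssignmentAt a s.mem (I.copyBase + (2 + (I.k + I.k)))

variable {I : MetroPath} {a : Assignment I} {W : ℕ} {s : State}

theorem Copied.setReg (h : Copied I a s) {r : ℕ} (hr : 4 < r) (v : ℕ) :
    Copied I a (s.setReg r v) where
  reg_zero := by rw [State.reg_setReg, if_neg (by omega), h.reg_zero]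
  reg_one := by rw [State.reg_setReg, if_neg (by omega), h.reg_one]
  reg_two := by rw [State.reg_setReg, if_neg (by omega), h.reg_two]
  reg_three := by rw [State.reg_setReg, if_neg (by omega), h.reg_three]
  reg_four := by rw [State.reg_setReg, if_neg (by omega), h.reg_four]
  input := h.input
  assignment := h.assignment

theorem Copied.setMem (h : Copied I a s) {i : ℕ}
    (hi : i < I.copyBase ∨ I.copyBase + (2 + (I.k + I.k)) + (I.k + I.k) ≤ i) (v : ℕ) :
    Copied I a (s.setMem i v) where
  reg_zero := h.reg_zero
  reg_one := h.reg_one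
  reg_two := h.reg_two
  reg_three := h.reg_three
  reg_four := h.reg_four
  input := h.input.congr fun x _ _ => by rw [State.mem_setMem, if_neg (by omega)]
  assignment l := by
    rw [State.mem_setMem, if_neg (by omega), State.mem_setMem, if_neg (by omega)]
    exact h.assignment l

theorem wp_computeKeys (hW : I.layoutBound ≤ W) (h : Copied I a s) (l : Fin I.k)
    (h7 : s.reg 7 = l) : WP W computeKeys (fun s' t => (Copied I a s' ∧
      (∀ r ≤ 9, s'.reg r = s.reg r) ∧ s'.reg 10 = I.startKey a.left l ∧
      s'.reg 11 = I.endKey a l ∧ s'.mem = s.mem) ∧ t ≤ 50) s := by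
  have hl := (h.input.2.2 l).1
  have hr := (h.input.2.2 l).2
  have hal := (h.assignment l).1
  have har := (h.assignment l).2
  have := I.left_lt_right l
  have := I.right_le l
  have := Bool.toNat_le (a.left l)
  have := Bool.toNat_le (a.right l)
  have hsl : I.startKey a.left l = if (a.left l).toNat < 1 then I.n - I.left l else
      I.n + I.left l := by
    unfold startKey; cases a.left l <;> simp
  have hel : I.endKey a l = if (a.right l).toNat < 1 then I.right l else
      I.n + I.n + 1 - I.right l := by
    unfold endKey; cases a.right l <;> simp
  have hpost : ∀ v w, Copied I a ((s.setReg 10 v).setReg 11 w) := fun v w =>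
    (h.setReg (by omega) _).setReg (by omega) _
  unfold layoutBound at hW
  simp only [computeKeys, wp_seq, wp_branch, wp_assign, eval, Fits, cost, State.reg_setReg,
    State.mem_setReg, Nat.reduceEqDiff, if_true, if_false, h7, h.reg_zero, h.reg_two, h.reg_three,
    hl, hr, hal, har, hsl, hel, hpost, true_and, and_true]
  refine ⟨by omega, fun c₁ => ⟨by omega, by omega, fun c₂ => ?_, fun c₂ => ?_⟩,
    fun c₁ => ⟨by omega, by omega, fun c₂ => ?_, fun c₂ => ?_⟩⟩
  all_goals
    refine ⟨by omega, ⟨fun r hr' => ?_, ?_, ?_⟩, by omega⟩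
    · rw [if_neg (by omega), if_neg (by omega)]
    · split_ifs; rfl
    · split_ifs; rfl

theorem emits_sortLines_loop (hW : I.layoutBound ≤ W) :
    Emits W (Copied I a) (I.copyBase + (2 + (I.k + I.k)) + (I.k + I.k)) I.k
      ((I.n + I.n + 1) * ((I.n + I.n + 1) * (I.k * 100 + 50) + 50) + 50)
      (forLoop 5 0 (add (add (reg 0) (reg 0)) (const 1)) <|
        forLoop 6 0 (add (add (reg 0) (reg 0)) (const 1)) <|
        forLoop 7 0 (reg 1) <| computeKeys.seq <|
        branch (add (dist (reg 5) (reg 10)) (dist (reg 6) (reg 11))) (const 1) (emit 7) skip)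
      ((I.sortedLines a).map Fin.val) := by
  have hW' := hW
  unfold layoutBound at hW'
  have hlist : (I.sortedLines a).map Fin.val = (List.range (I.n + I.n + 1)).flatMap fun x =>
      (List.range (I.n + I.n + 1)).flatMap fun y => (List.finRange I.k).flatMap fun l =>
        if I.startKey a.left l = x ∧ I.endKey a l = y then [l.val] else [] := by
    simp only [sortedLines, List.map_flatMap, List.map_filter_eq_flatMap]
  rw [hlist]
  have hbound : ∀ s, Copied I a s →
      (add (add (reg 0) (reg 0)) (const 1)).Fits W s ∧
      (add (add (reg 0) (reg 0)) (const 1)).eval s = (List.range (I.n + I.n + 1)).length := by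
    intro s hs
    simp only [Fits, eval, hs.reg_zero, List.length_range, and_true]
    omega
  refine Emits.mono (emits_forLoop_list (List.range (I.n + I.n + 1))
    (T := (I.n + I.n + 1) * (I.k * 100 + 50) + 30) (by omega) (by simp; omega)
    (fun s u hs => hs.setReg (by omega) u) hbound fun x hx => ?_) ?_
  swap
  · simp only [cost, List.length_range]
    exact mul_add_add_le _ (by omega) (by omega)
  rw [List.length_range] at hx
  refine Emits.mono (emits_forLoop_list (List.range (I.n + I.n + 1)) (T := I.k * 100 + 30)
    (by omega) (by simp; omega)
    (fun s u hs => ⟨hs.1.setReg (by omega) u, by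
      rw [State.reg_setReg, if_neg (by omega), hs.2]⟩) (fun s hs => hbound s hs.1)
      fun y hy => ?_) ?_
  swap
  · simp only [cost, List.length_range]
    exact mul_add_add_le _ (by omega) (by omega)
  rw [List.length_range] at hy
  refine Emits.mono (emits_forLoop_list (List.finRange I.k) (T := 80)
    (by omega) (by simp; omega)
    (fun s u hs => ⟨⟨hs.1.1.setReg (by omega) u, by
      rw [State.reg_setReg, if_neg (by omega), hs.1.2]⟩, by
      rw [State.reg_setReg, if_neg (by omega), hs.2]⟩)
      (fun s hs => by
        simp only [Fits, eval, hs.1.1.reg_one, List.length_finRange, and_true]; omega)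
      fun l hl => ?_) ?_
  swap
  · simp only [cost, List.length_finRange]
    omega
  rw [List.length_finRange] at hl
  simp only [List.getElem_range, List.getElem_finRange, Fin.cast_mk]
  have hs₁ := I.startKey_lt a.left ⟨l, hl⟩
  have he₁ := I.endKey_lt a ⟨l, hl⟩
  refine Emits.mono (emits_prepare (Env' := fun s => (((Copied I a s ∧ s.reg 5 = x) ∧ s.reg 6 = y) ∧
    s.reg 7 = l) ∧ s.reg 10 = I.startKey a.left ⟨l, hl⟩ ∧ s.reg 11 = I.endKey a ⟨l, hl⟩)
    (T₁ := 50) (T₂ := 30) ?_ ?_ fun s hs => hs.1) (by omega)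
  · rintro s ⟨⟨⟨hs, h5⟩, h6⟩, h7⟩
    refine (wp_computeKeys hW hs ⟨l, hl⟩ h7).mono ?_
    rintro s' t ⟨⟨hs', hr, h10, h11, hm⟩, ht⟩
    refine ⟨⟨⟨⟨⟨⟨hs', ?_⟩, ?_⟩, ?_⟩, h10, h11⟩, ?_, hm⟩, ht⟩
    · rw [hr 5 (by omega), h5]
    · rw [hr 6 (by omega), h6]
    · rw [hr 7 (by omega), h7]
    · rw [hr 9 (by omega)]
  · refine Emits.mono (emits_branch _ ?_ (emits_emit (by omega) (by omega) (fun s hs => hs.1.2)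
      ?_ ?_) (by omega)) (by simp only [cost]; omega)
    · rintro s ⟨⟨⟨⟨hs, h5⟩, h6⟩, h7⟩, h10, h11⟩
      simp only [Fits, eval, h5, h6, h10, h11]
      omega
    · rintro s i u hi ⟨⟨⟨⟨hs, h5⟩, h6⟩, h7⟩, h10, h11⟩
      exact ⟨⟨⟨⟨hs.setMem (by omega) u, h5⟩, h6⟩, h7⟩, h10, h11⟩
    · rintro s u ⟨⟨⟨⟨hs, h5⟩, h6⟩, h7⟩, h10, h11⟩
      simp only [State.reg_setReg, Nat.reduceEqDiff, if_false]
      exact ⟨⟨⟨⟨hs.setReg (by omega) u, h5⟩, h6⟩, h7⟩, h10, h11⟩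

/-- The machine state after the lines have been sorted. -/
structure Sorted (I : MetroPath) (a : Assignment I) (s : State) : Prop where
  copied : Copied I a s
  sorted : ∀ i v, ((I.sortedLines a).map Fin.val)[i]? = some v →
    s.mem (I.copyBase + (2 + (I.k + I.k)) + (I.k + I.k) + i) = v

theorem Sorted.setReg (h : Sorted I a s) {r : ℕ} (hr : 4 < r) (v : ℕ) :
    Sorted I a (s.setReg r v) := ⟨h.copied.setReg hr v, h.sorted⟩

theorem Sorted.setMem (h : Sorted I a s) {i : ℕ} (hi : i < I.copyBase) (v : ℕ) :
    Sorted I a (s.setMem i v) :=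
  ⟨h.copied.setMem (Or.inl hi) v, fun j w hj => by
    rw [State.mem_setMem, if_neg (by omega)]; exact h.sorted j w hj⟩

theorem wp_sortLines (hW : I.layoutBound ≤ W) (h : Copied I a s) :
    WP W sortLines (fun s' t => Sorted I a s' ∧
      t ≤ (I.n + I.n + 1) * ((I.n + I.n + 1) * (I.k * 100 + 50) + 50) + 60) s := by
  have hW' := hW
  unfold layoutBound at hW'
  rw [sortLines, wp_seq, wp_assign]
  simp only [eval, Fits, cost, h.reg_four]
  refine ⟨by omega, ?_⟩
  refine (emits_sortLines_loop hW _ [] (h.setReg (by omega) _) ⟨?_, by simp⟩ ?_).mono ?_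
  · rw [State.reg_setReg, if_pos rfl]; rfl
  · simp [length_sortedLines]
  · rintro s' t ⟨⟨hs', hem⟩, ht⟩
    exact ⟨⟨hs', hem.2⟩, by omega⟩

theorem wp_computeGroup (hW : I.layoutBound ≤ W) (h : Sorted I a s) {e j : ℕ} (he : e < I.n)
    (h5 : s.reg 5 = e) (hj : j < (I.sortedLines a).length) (h7 : s.reg 7 = j) :
    WP W computeGroup (fun s' t => (Sorted I a s' ∧ (∀ r, r ≤ 7 ∨ r = 9 → s'.reg r = s.reg r) ∧
      s'.reg 8 = ((I.sortedLines a)[j] : Fin I.k) ∧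
      s'.reg 10 = I.group a e (I.sortedLines a)[j] ∧ s'.mem = s.mem) ∧ t ≤ 60) s := by
  have hs := h.sorted j ((I.sortedLines a)[j] : Fin I.k) (by simp [hj])
  generalize (I.sortedLines a)[j] = l at hs ⊢
  have hc := h.copied
  have hl := (hc.input.2.2 l).1
  have hr := (hc.input.2.2 l).2
  have har := (hc.assignment l).2
  have := I.left_lt_right l
  have := I.right_le l
  have := Bool.toNat_le (a.right l)
  rw [length_sortedLines] at hj
  have hpost : ∀ v w, Sorted I a ((s.setReg 8 v).setReg 10 w) := fun v w =>
    (h.setReg (by omega) _).setReg (by omega) _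
  unfold layoutBound at hW
  simp only [computeGroup, wp_seq, wp_branch, wp_assign, eval, Fits, cost, State.reg_setReg,
    State.mem_setReg, Nat.reduceEqDiff, if_true, if_false, h5, h7, hc.reg_two, hc.reg_three,
    hc.reg_four, hs, hl, hr, har, hpost, true_and, and_true, group]
  have hrest : ∀ u v : ℕ, ∀ r, r ≤ 7 ∨ r = 9 →
      (if r = 10 then u else if r = 8 then v else s.reg r) = s.reg r := fun u v r hr' => by
    rw [if_neg (by omega), if_neg (by omega)]
  refine ⟨by omega, by omega, fun c₁ => ⟨by omega, ⟨hrest _ _, ?_⟩, by omega⟩, fun c₁ =>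
    ⟨by omega, fun c₂ => ⟨by omega, fun c₃ => ⟨by omega, ⟨hrest _ _, ?_⟩, by omega⟩,
      fun c₃ => ⟨by omega, ⟨hrest _ _, ?_⟩, by omega⟩⟩,
      fun c₂ => ⟨by omega, ⟨hrest _ _, ?_⟩, by omega⟩⟩⟩
  · rw [if_pos c₁]
  · rw [if_neg c₁, if_pos c₂, if_pos c₃]
  · rw [if_neg c₁, if_pos c₂, if_neg c₃]
  · rw [if_neg c₁, if_neg c₂]

/-- A loop over the sorted lines that writes those that satisfy a test on their group. -/
theorem emits_filter {Env : State → Prop} (hW : I.layoutBound ≤ W)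
    (hS : ∀ s, Env s → Sorted I a s) {e : ℕ} (he : e < I.n) (h5 : ∀ s, Env s → s.reg 5 = e)
    (hreg : ∀ s r u, 6 < r → Env s → Env (s.setReg r u))
    (hmem : ∀ s i u, i < I.copyBase → Env s → Env (s.setMem i u))
    (hEnv : ∀ s s' : State, Env s → Sorted I a s' → (∀ r ≤ 6, s'.reg r = s.reg r) → Env s')
    (p : ℕ → Prop) [DecidablePred p] {x y : Expr} (hxy : x.cost + y.cost ≤ 12)
    (h : ∀ s g, Env s → s.reg 10 = g → g ≤ 3 →
      (x.Fits W s ∧ y.Fits W s) ∧ (x.eval s < y.eval s ↔ p g)) :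
    Emits W Env 0 I.copyBase (I.k * 100 + 10)
      (forLoop 7 0 (reg 1) <| computeGroup.seq <| branch x y (emit 8) skip)
      (((I.sortedLines a).filter fun l => p (I.group a e l)).map Fin.val) := by
  have hW' := hW
  unfold layoutBound at hW'
  rw [List.map_filter_eq_flatMap (I.sortedLines a) (fun l => p (I.group a e l))]
  refine Emits.mono (emits_forLoop_list (I.sortedLines a) (T := 80) (by omega)
    (by rw [length_sortedLines]; omega) (fun s u hs => hreg s 7 u (by omega) hs)
    (fun s hs => ?_) fun j hj => ?_) ?_
  · rw [length_sortedLines]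
    simp only [Fits, eval, (hS s hs).copied.reg_one, and_true]
    omega
  · refine Emits.mono (emits_prepare (Env' := fun s => (Env s ∧ s.reg 7 = j) ∧
      s.reg 8 = ((I.sortedLines a)[j] : Fin I.k) ∧ s.reg 10 = I.group a e (I.sortedLines a)[j])
      (T₁ := 60) (T₂ := 20) ?_ ?_ fun s hs => hs.1) (by omega)
    · rintro s ⟨hs, h7⟩
      refine (wp_computeGroup hW (hS s hs) he (h5 s hs) hj h7).mono ?_
      rintro s' t ⟨⟨hs', hr, h8, h10, hm⟩, ht⟩
      refine ⟨⟨⟨⟨hEnv s s' hs hs' fun r hr' => hr r (by omega), ?_⟩, h8, h10⟩, ?_, hm⟩, ht⟩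
      · rw [hr 7 (by omega), h7]
      · rw [hr 9 (by omega)]
    · refine Emits.mono (emits_branch _ ?_ (emits_emit (by omega)
        ((((I.sortedLines a)[j] : Fin I.k).2.le).trans (by omega)) (fun s hs => hs.2.1) ?_ ?_)
        (by omega)) (by omega)
      · rintro s ⟨⟨hs, -⟩, -, h10⟩
        refine h s _ hs h10 ?_
        have := Bool.toNat_le (a.right (I.sortedLines a)[j])
        unfold group; split_ifs <;> omega
      · rintro s i u hi ⟨⟨hs, h7⟩, h8, h10⟩
        exact ⟨⟨hmem s _ u (by omega) hs, h7⟩, h8, h10⟩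
      · rintro s u ⟨⟨hs, h7⟩, h8, h10⟩
        simp only [State.reg_setReg, Nat.reduceEqDiff, if_false]
        exact ⟨⟨hreg s 9 u (by omega) hs, h7⟩, h8, h10⟩
  · rw [length_sortedLines]
    simp only [cost]
    omega

theorem encode_keyLayout (I : MetroPath) (a : Assignment I) : (I.keyLayout a).encode =
    (List.range' 1 (I.n - 1)).flatMap fun e =>
      ((I.sortedLines a).filter fun l => I.group a e l < 3).map Fin.val ++
        (List.range 3).flatMap fun g =>
          ((I.sortedLines a).filter fun l => I.group a e l = g).map Fin.val := by
  simp only [Layout.encode, keyLayout, farLines, List.map_append, List.map_flatMap]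

theorem Layout.length_encode_le (Λ : Layout I) : Λ.encode.length ≤ I.n * (I.k + I.k) := by
  refine (List.length_flatMap_le _ _ (I.k + I.k) fun e _ => ?_).trans ?_
  · have h₁ := (Λ.near_nodup e).length_le_card
    have h₂ := (Λ.far_nodup e).length_le_card
    rw [Fintype.card_fin] at h₁ h₂
    rw [List.length_map, List.length_append]
    omega
  · rw [List.length_range']
    exact Nat.mul_le_mul_right _ (Nat.sub_le _ _)

theorem wp_writeLayout (hW : I.layoutBound ≤ W) (h : Sorted I a s) :
    WP W writeLayout (fun s' t => Holds s' (I.keyLayout a).encode ∧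
      t ≤ (I.n - 1) * (I.k * 400 + 200) + 20) s := by
  have hW' := hW
  unfold layoutBound at hW'
  have hlen := (I.keyLayout a).length_encode_le
  have key : Emits W (Sorted I a) 0 I.copyBase ((I.n - 1) * (I.k * 400 + 200) + 10)
      (forLoop 5 1 (reg 0) <|
        (forLoop 7 0 (reg 1) <| computeGroup.seq <| branch (reg 10) (const 3) (emit 8) skip).seq <|
        forLoop 6 0 (const 3) <| forLoop 7 0 (reg 1) <| computeGroup.seq <|
        branch (dist (reg 6) (reg 10)) (const 1) (emit 8) skip) (I.keyLayout a).encode := by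
    rw [encode_keyLayout]
    refine Emits.mono (emits_forLoop (T := I.k * 400 + 180) (by omega) (by omega)
      (fun s u hs => hs.setReg (by omega) u) (fun s m hs hm => ?_) fun m hm => ?_) ?_
    · simp only [Fits, eval, hs.copied.reg_zero]
      omega
    · refine Emits.mono (emits_seq (T₁ := I.k * 100 + 10) (T₂ := I.k * 300 + 150)
        (emits_filter hW (fun s hs => hs.1) (e := 1 + m) (by omega) (fun s hs => hs.2) ?_ ?_ ?_
          (fun g => g < 3) (by simp only [cost]; omega) ?_)
        (Emits.mono (emits_forLoop_list (List.range 3) (T := I.k * 100 + 10) (by omega)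
          (by simp; omega) ?_ ?_ fun g hg => ?_) ?_)) (by omega)
      · rintro s r u hr ⟨hs, h5⟩
        exact ⟨hs.setReg (by omega) u, by rw [State.reg_setReg, if_neg (by omega), h5]⟩
      · rintro s i u hi ⟨hs, h5⟩
        exact ⟨hs.setMem hi u, h5⟩
      · rintro s s' ⟨-, h5⟩ hs' hr
        exact ⟨hs', by rw [hr 5 (by omega), h5]⟩
      · rintro s g ⟨hs, h5⟩ h10 hg
        simp only [Fits, eval, h10, and_true]
        omega
      · rintro s u ⟨hs, h5⟩
        exact ⟨hs.setReg (by omega) u, by rw [State.reg_setReg, if_neg (by omega), h5]⟩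
      · rintro s ⟨hs, h5⟩
        simp only [Fits, eval, List.length_range, and_true]
        omega
      · rw [List.length_range] at hg
        rw [List.getElem_range]
        refine emits_filter hW (fun s hs => hs.1.1) (e := 1 + m) (by omega)
          (fun s hs => hs.1.2) ?_ ?_ ?_ (fun i => i = g) (by simp only [cost]; omega) ?_
        · rintro s r u hr ⟨⟨hs, h5⟩, h6⟩
          exact ⟨⟨hs.setReg (by omega) u, by rw [State.reg_setReg, if_neg (by omega), h5]⟩, by
            rw [State.reg_setReg, if_neg (by omega), h6]⟩
        · rintro s i u hi ⟨⟨hs, h5⟩, h6⟩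
          exact ⟨⟨hs.setMem hi u, h5⟩, h6⟩
        · rintro s s' ⟨⟨-, h5⟩, h6⟩ hs' hr
          exact ⟨⟨hs', by rw [hr 5 (by omega), h5]⟩, by rw [hr 6 (by omega), h6]⟩
        · rintro s i ⟨⟨hs, h5⟩, h6⟩ h10 hi
          simp only [Fits, eval, h6, h10]
          omega
      · simp only [List.length_range, cost]
        omega
    · simp only [cost]
      exact mul_add_add_le _ (by omega) (by omega)
  rw [writeLayout, wp_seq, wp_assign]
  simp only [eval, Fits, cost]
  refine ⟨by omega, ?_⟩
  refine (key _ [] (h.setReg (by omega) _) ⟨?_, by simp⟩ ?_).mono ?_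
  · rw [State.reg_setReg, if_pos rfl]; rfl
  · unfold copyBase; simp only [List.length_nil]; omega
  · rintro s' t ⟨⟨-, hem⟩, ht⟩
    refine ⟨(holds_iff _ _).2 fun i v hi => ?_, by omega⟩
    simpa using hem.2 i v (by simpa using hi)

theorem wp_copyInput (hW : I.layoutBound ≤ W) (hin : I.InputAt s.mem 0)
    (ha : AssignmentAt a s.mem (2 + I.k + I.k)) :
    WP W copyInput (fun s' t => Copied I a s' ∧ t ≤ I.n * 20 + I.k * 100 + 150) s := by
  unfold layoutBound at hW
  have hle : ∀ i ≤ I.n, i * (I.k + I.k) ≤ I.n * (I.k + I.k) := fun i hi =>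
    Nat.mul_le_mul_right _ hi
  have hval : ∀ i < 2 + (I.k + I.k) + (I.k + I.k), s.mem i ≤ W := by
    intro i hi
    by_cases h₀ : i = 0
    · rw [h₀, hin.1]; omega
    by_cases h₁ : i = 1
    · rw [h₁, show s.mem 1 = I.k from hin.2.1]; omega
    by_cases h₂ : i < 2 + (I.k + I.k)
    · have hl : (i - 2) / 2 < I.k := by omega
      have hh := hin.2.2 ⟨_, hl⟩
      have := I.left_lt_right ⟨_, hl⟩
      have := I.right_le ⟨_, hl⟩
      simp only [zero_add] at hh
      rcases Nat.mod_two_eq_zero_or_one i with hm | hm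
      · rw [show i = 2 + ((i - 2) / 2 + (i - 2) / 2) by omega, hh.1]; omega
      · rw [show i = 3 + ((i - 2) / 2 + (i - 2) / 2) by omega, hh.2]; omega
    · have hl : (i - (2 + (I.k + I.k))) / 2 < I.k := by omega
      have hh := ha ⟨_, hl⟩
      have := Bool.toNat_le (a.left ⟨_, hl⟩)
      have := Bool.toNat_le (a.right ⟨_, hl⟩)
      simp only at hh
      rcases Nat.mod_two_eq_zero_or_one i with hm | hm
      · rw [show i = 2 + I.k + I.k + ((i - (2 + (I.k + I.k))) / 2 +
          (i - (2 + (I.k + I.k))) / 2) by omega, hh.1]; omega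
      · rw [show i = 2 + I.k + I.k + ((i - (2 + (I.k + I.k))) / 2 +
          (i - (2 + (I.k + I.k))) / 2 + 1) by omega, hh.2]; omega
  have h0 : s.mem 0 = I.n := hin.1
  have h1 : s.mem 1 = I.k := hin.2.1
  have hbase : I.copyBase = 2 + (I.k + I.k) + (I.k + I.k) + I.n * (I.k + I.k) := rfl
  simp only [copyInput, wp_seq, wp_assign, eval, Fits, cost, State.reg_setReg,
    State.mem_setReg, Nat.reduceEqDiff, if_true, if_false, h0, h1]
  refine ⟨by omega, by omega, by omega, by omega, ?_⟩
  refine wp_loop I.n 10 (fun i s' => s'.mem = s.mem ∧ s'.reg 0 = I.n ∧ s'.reg 1 = I.k ∧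
    s'.reg 2 = 2 + (I.k + I.k) + (I.k + I.k) + i * (I.k + I.k) ∧ s'.reg 5 = i) ?_ ?_ ?_ ?_
  · rintro i s' hi ⟨-, h0, h1, h2, h5⟩
    simp only [Fits, eval, h0, h5, and_true]
    omega
  · rintro i s' hi ⟨hm, h0, h1, h2, h5⟩
    have := hle (i + 1) (by omega)
    have hs := Nat.succ_mul i (I.k + I.k)
    rw [Nat.succ_eq_add_one] at hs
    simp only [wp_seq, wp_assign, eval, Fits, cost, State.reg_setReg,
      State.mem_setReg, Nat.reduceEqDiff, if_true, if_false, h0, h1, h2, h5, hm, true_and,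
      and_true]
    omega
  · simp [State.reg_setReg, State.mem_setReg]
  rintro s₁ t₁ ⟨hm₁, h0₁, h1₁, h2₁, -⟩ ht₁
  rw [← hbase] at h2₁
  simp only [cost] at ht₁
  refine ⟨by omega, ?_⟩
  refine wp_loop (2 + (I.k + I.k) + (I.k + I.k)) 12 (fun i s' => s'.reg 0 = I.n ∧
    s'.reg 1 = I.k ∧ s'.reg 2 = I.copyBase ∧ s'.reg 5 = i ∧
    (∀ j < I.copyBase, s'.mem j = s.mem j) ∧
    ∀ j < i, s'.mem (I.copyBase + j) = s.mem j) ?_ ?_ ?_ ?_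
  · rintro i s' hi ⟨h0, h1, h2, h5, -⟩
    simp only [Fits, eval, h1, h5, and_true]
    omega
  · rintro i s' hi ⟨h0, h1, h2, h5, hm, hc⟩
    have := hval i hi
    simp only [wp_seq, wp_assign, wp_store, eval, Fits, cost, State.reg_setReg, State.reg_setMem,
      State.mem_setReg, State.mem_setMem, Nat.reduceEqDiff, if_true, if_false, h0, h1, h2, h5,
      hm i (by omega), true_and]
    refine ⟨by omega, by omega, ⟨fun j hj => ?_, fun j hj => ?_⟩, by omega⟩
    · rw [if_neg (by omega), hm j hj]
    · split_ifs with hji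
      · rw [show j = i by omega]
      · exact hc j (by omega)
  · simp [State.reg_setReg, State.mem_setReg, h0₁, h1₁, h2₁, hm₁]
  rintro s₂ t₂ ⟨h0₂, h1₂, h2₂, -, -, hc⟩ ht₂
  simp only [cost] at ht₂
  simp only [h1₂, h2₂]
  refine ⟨by omega, by omega, ⟨?_, ?_, ?_, ?_, ?_, ⟨?_, ?_, fun l => ?_⟩, fun l => ?_⟩, by omega⟩
  · simpa [State.reg_setReg] using h0₂
  · simpa [State.reg_setReg] using h1₂
  · simpa [State.reg_setReg] using h2₂
  · simp [State.reg_setReg]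
  · simp [State.reg_setReg]
  · exact (hc 0 (by omega)).trans h0
  · exact (hc 1 (by omega)).trans h1
  · have := hin.2.2 l
    simp only [zero_add] at this
    exact ⟨(hc _ (by omega)).trans this.1, (hc _ (by omega)).trans this.2⟩
  · have := ha l
    simp only [add_assoc] at this ⊢
    exact ⟨(hc _ (by omega)).trans this.1, (hc _ (by omega)).trans this.2⟩

theorem computes_findLayout (hW : I.layoutBound ≤ W) (a : Assignment I) :
    Computes W ((I.n + I.n + 1) * ((I.n + I.n + 1) * (I.k * 100 + 50) + 50) +
      I.n * (I.k * 400 + 200) + I.n * 20 + I.k * 100 + 250) findLayout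
      (I.encode ++ a.encode) (I.keyLayout a).encode := by
  intro s hs
  obtain ⟨hin, ha⟩ := (holds_append_iff a s).1 hs
  suffices h : WP W findLayout (fun s' t => t ≤ (I.n + I.n + 1) * ((I.n + I.n + 1) *
      (I.k * 100 + 50) + 50) + I.n * (I.k * 400 + 200) + I.n * 20 + I.k * 100 + 250 ∧
      Holds s' (I.keyLayout a).encode) s from h
  rw [findLayout, wp_seq]
  refine (wp_copyInput hW hin ha).mono ?_
  rintro s₁ t₁ ⟨hs₁, ht₁⟩
  rw [wp_seq]
  refine (wp_sortLines hW hs₁).mono ?_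
  rintro s₂ t₂ ⟨hs₂, ht₂⟩
  refine (wp_writeLayout hW hs₂).mono ?_
  rintro s₃ t₃ ⟨hs₃, ht₃⟩
  have : (I.n - 1) * (I.k * 400 + 200) ≤ I.n * (I.k * 400 + 200) :=
    Nat.mul_le_mul_right _ (Nat.sub_le _ _)
  exact ⟨by omega, hs₃⟩

end MetroPath

/-! ### The bounds on time and word size -/

namespace MetroPath

theorem searchTime_le (k : ℕ) :
    2 ^ k * (roundTime k + 10) + k * 50 + 100 ≤ 1000 * (2 ^ k * k ^ 2 + 1) := by
  rcases Nat.eq_zero_or_pos k with rfl | hk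
  · simp [roundTime]
  · have h₁ : k ≤ k ^ 2 := Nat.le_self_pow two_ne_zero k
    have h₂ : roundTime k + 10 ≤ 390 * k ^ 2 := by unfold roundTime; nlinarith
    have h₃ : 2 ^ k * (roundTime k + 10) ≤ 390 * (2 ^ k * k ^ 2) :=
      (Nat.mul_le_mul_left _ h₂).trans (by rw [mul_left_comm])
    have h₄ : k ^ 2 ≤ 2 ^ k * k ^ 2 := Nat.le_mul_of_pos_left _ (by positivity)
    omega

theorem layoutTime_le (n k : ℕ) :
    (n + n + 1) * ((n + n + 1) * (k * 100 + 50) + 50) + n * (k * 400 + 200) + n * 20 + k * 100 + 250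
      ≤ 2000 * (n + k + 1) ^ 3 := by
  obtain ⟨N, hN⟩ : ∃ N, N = n + k + 1 := ⟨_, rfl⟩
  rw [← hN]
  have h₁ : N ≤ N ^ 3 := Nat.le_self_pow (by norm_num) N
  have h₂ : N ^ 2 ≤ N ^ 3 := Nat.pow_le_pow_right (by omega) (by norm_num)
  calc (n + n + 1) * ((n + n + 1) * (k * 100 + 50) + 50) + n * (k * 400 + 200) + n * 20 +
        k * 100 + 250
      ≤ (2 * N) * ((2 * N) * (100 * N) + 50) + N * (400 * N) + N * 20 + N * 100 + 250 := by
        gcongr <;> omega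
    _ = 400 * N ^ 3 + 400 * N ^ 2 + 220 * N + 250 := by ring
    _ ≤ 2000 * N ^ 3 := by omega

theorem searchBound_le (n k : ℕ) :
    2 * n + k * k + 6 * k + 10 ≤ 2000 * (n + k + 1) ^ 3 := by
  have h₁ : (n + k + 1) ^ 2 ≤ (n + k + 1) ^ 3 := Nat.pow_le_pow_right (by omega) (by norm_num)
  nlinarith [Nat.zero_le (n * k), Nat.zero_le (n * n)]

theorem layoutBound_le (I : MetroPath) : I.layoutBound ≤ 2000 * (I.n + I.k + 1) ^ 3 := by
  have h₁ : (I.n + I.k + 1) ^ 2 ≤ (I.n + I.k + 1) ^ 3 :=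
    Nat.pow_le_pow_right (by omega) (by norm_num)
  unfold layoutBound copyBase
  nlinarith [Nat.zero_le (I.n * I.k), Nat.zero_le (I.n * I.n), Nat.zero_le (I.k * I.k)]

end MetroPath

theorem mainTheorem3 :
    ∃ (A B : RAM.Program) (C d : ℕ), ∀ I : MetroPath,
      (∃ a : I.Assignment, a.Optimal ∧
        RAM.Computes (C * (I.n + I.k + 1) ^ d) (C * (2 ^ I.k * I.k ^ 2 + 1)) A
          I.encode (I.encode ++ a.encode)) ∧
      (∀ a : I.Assignment, ∃ Λ : I.Layout, Λ.SolvesPA a ∧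
        RAM.Computes (C * (I.n + I.k + 1) ^ d) (C * (I.n + I.k + 1) ^ d) B
          (I.encode ++ a.encode) Λ.encode) ∧
      (∃ Λ : I.Layout, Λ.SolvesP ∧
        RAM.Computes (C * (I.n + I.k + 1) ^ d)
          (C * (2 ^ I.k * I.k ^ 2 + (I.n + I.k + 1) ^ d)) (A.seq B)
          I.encode Λ.encode) := by
  refine ⟨.findAssignment, .findLayout, 4000, 3, fun I => ?_⟩
  have hA := (MetroPath.computes_findAssignment (I := I) le_rfl).mono
    (MetroPath.searchBound_le I.n I.k) (MetroPath.searchTime_le I.k)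
  have hB := fun a => (MetroPath.computes_findLayout (I := I) le_rfl a).mono I.layoutBound_le
    (MetroPath.layoutTime_le I.n I.k)
  have hpos : 1 ≤ (I.n + I.k + 1) ^ 3 := Nat.one_le_pow _ _ (by omega)
  refine ⟨⟨I.bestAssignment, ⟨_, I.keyLayout_respects _, I.keyLayout_bestAssignment_solvesP⟩,
    hA.mono (by omega) (by omega)⟩, fun a => ⟨_, I.keyLayout_solvesPA a,
    (hB a).mono (by omega) (by omega)⟩, _, I.keyLayout_bestAssignment_solvesP,
    (hA.seq (hB _)).mono (by omega) (by omega)⟩
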